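/- Let $(X,d)$ be a complete metric space, $\lambda\le 0$, and let $\phi:X\to(-\infty,\infty]$ be lower semi-continuous. Write $D(\phi)=\{\phi<\infty\}$ and fix $x_0\in D(\phi)$. A minimal geodesic is a map $\gamma:[0,1]\to X$ with $d(\gamma(s),\gamma(t))=|s-t|\,d(\gamma(0),\gamma(1))$ for all $s,t$. For $\tau>0$ put $\phi_\tau(x)=\inf_{z\in X}\{\phi(z)+d^2(x,z)/(2\tau)\}$ and let $J_\tau(x)$ be the set of points $z$ attaining this infimum. Assume: * ($\lambda$-convexity) any $x,y\in D(\phi)$ are joined by a minimal geodesic $\gamma$ with $\phi(\gamma(t))\le(1-t)\phi(x)+t\phi(y)-\frac{\lambda}{2}(1-t)t\,d^2(x,y)$ for all $t\in[0,1]$; * (coercivity) for some $\tau_*\in(0,\infty]$, one has $\phi_\tau(x)>-\infty$ and $J_\tau(x)\ne\emptyset$ for all $x\in X$ and $0<\tau<\tau_*$. Let $K\in\mathbb{R}$ and assume that one of the following holds: * (I) $X$ is a $\mathrm{CAT}(1)$-space with $\operatorname{diam}X<\pi/2$ (in this case $K$ is arbitrary; in particular the estimate below holds with $K'=0$); * (II)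 there is a family of minimal geodesics, joining any two points of $D(\phi)$, such that $\phi$ satisfies the $\lambda$-convexity inequality along each of its members with end points in $D(\phi)$; $d^2(z,\gamma(t))\le(1-t)d^2(z,\gamma(0))+t\,d^2(z,\gamma(1))-\frac K2(1-t)t\,d^2(\gamma(0),\gamma(1))$ for every member $\gamma$, $z\in X$ and $t\in[0,1]$; and, for any members $\gamma,\eta$ with $\gamma(0)=\eta(0)=x$, $\gamma(1)=y$ and $\eta(1)=z$, the limits $\lim_{s\downarrow0}\frac{d^2(\gamma(s),z)-d^2(x,z)}{s}$ and $\lim_{t\downarrow0}\frac{d^2(\eta(t),y)-d^2(x,y)}{t}$ exist and coincide. For a partition $\boldsymbol\tau:\ 0=t^0<t^1<\cdots\to\infty$ put $\tau_k=t^k-t^{k-1}$ and $|\boldsymbol\tau|=\sup_k\tau_k$. A discrete solution from $x_0$ associated with $\boldsymbol\tau$ is a sequence with $x^0=x_0$ and $x^k\in J_{\tau_k}(x^{k-1})$ for $k\ge1$. Its interpolations are $\bar x_{\boldsymbol\tau}(0)=x_0$ and, for $t\in(t^{k-1},t^k]$, $$\bar x_{\boldsymbol\tau}(t)=x^k,\qquad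 \bar d_{\boldsymbol\tau}(t;y)=\Big\{d^2(x^{k-1},y)+\tfrac{t-t^{k-1}}{\tau_k}\big(d^2(x^k,y)-d^2(x^{k-1},y)\big)\Big\}^{1/2}.$$ A gradient curve from $x_0$ is a curve $\xi:[0,\infty)\to X$ that is the pointwise limit of interpolated curves $\bar x_{\boldsymbol\tau_i}$ of discrete solutions from $x_0$, for some sequence of partitions with $|\boldsymbol\tau_i|\to0$. Then there is exactly one gradient curve $\xi$ from $x_0$, written $\xi(t)=\mathcal G(t,x_0)$. For every partition $\boldsymbol\tau$ with $|\boldsymbol\tau|<\tau_*$, every associated discrete solution from $x_0$ and every $t>0$, $$\bar d_{\boldsymbol\tau}^{\,2}(t;\xi(t))\le e^{-2\lambda t}\left(\sqrt{1-K'-\tfrac{2\lambda}{3}|\boldsymbol\tau|}+\sqrt{-\tfrac{4\lambda}{3}|\boldsymbol\tau|}\right)^{2}|\boldsymbol\tau|\,\big\{\phi(x_0)-\phi(\bar x_{\boldsymbol\tau}(t))\big\},\qquad K'=\min\{0,K\}.$$ In particular, for every $T>0$ there are $C\in\mathbb R$ and $\delta>0$ such that $\bar d_{\boldsymbol\tau}(t;\xi(t))\le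 C\sqrt{|\boldsymbol\tau|}$ for all $t\in(0,T]$, all partitions with $|\boldsymbol\tau|<\delta$ and all associated discrete solutions from $x_0$. -/

import Mathlib

open Set Filter Topology
open scoped ENNReal

noncomputable section

namespace MetricGF

/-! ### Geodesics, `CAT(1)` spaces -/

/-- `γ : [0,1] → X` (a function on `ℝ` of which only the values on `[0,1]` matter) is a minimal
geodesic from `x` to `y`. -/
def IsMinGeodesic {X : Type*} [MetricSpace X] (γ : ℝ → X) (x y : X) : Prop :=
  γ 0 = x ∧ γ 1 = y ∧
    ∀ s ∈ Icc (0 : ℝ) 1, ∀ t ∈ Icc (0 : ℝ) 1, dist (γ s) (γ t) = |s - t| * dist x y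

/-- The unit sphere `𝕊²` in Euclidean 3-space. -/
abbrev Sphere2 : Type := Metric.sphere (0 : EuclideanSpace ℝ (Fin 3)) 1

/-- The angular (great circle) distance on `𝕊²`. -/
def sphereDist (p q : Sphere2) : ℝ :=
  InnerProductGeometry.angle (p : EuclideanSpace ℝ (Fin 3)) (q : EuclideanSpace ℝ (Fin 3))

/-- `CAT(1)` spaces: geodesic spaces all of whose triangles `xyz` of perimeter `< 2π` are not
thicker than their comparison triangles `x'y'z'` in `𝕊²`.  The point `p` at distance `t d(y,z)`
from `y'` and `(1-t) d(y,z)` from `z'` is the point at time `t` of the (unique, as `d(y,z) < π`)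
minimal geodesic of `𝕊²` from `y'` to `z'`. -/
def IsCAT1 (X : Type*) [MetricSpace X] : Prop :=
  (∀ x y : X, ∃ γ : ℝ → X, IsMinGeodesic γ x y) ∧
  ∀ x y z : X, dist x y + dist y z + dist z x < 2 * Real.pi →
    ∀ γ : ℝ → X, IsMinGeodesic γ y z →
    ∀ x' y' z' : Sphere2, sphereDist x' y' = dist x y → sphereDist y' z' = dist y z →
      sphereDist z' x' = dist z x →
    ∀ t ∈ Icc (0 : ℝ) 1, ∀ p : Sphere2,
      sphereDist y' p = t * dist y z → sphereDist p z' = (1 - t) * dist y z →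
      dist x (γ t) ≤ sphereDist x' p

/-! ### Functions `φ : X → (-∞, ∞]`, convexity, the Moreau–Yosida approximation -/

/-- The `l`-convexity inequality of `φ` along `γ : [0,1] → X`; it is used only when `φ` is finite
at the end points. -/
def ConvexAlong {X : Type*} [MetricSpace X] (φ : X → EReal) (l : ℝ) (γ : ℝ → X) : Prop :=
  ∀ t ∈ Icc (0 : ℝ) 1,
    φ (γ t) ≤ (((1 - t) * (φ (γ 0)).toReal + t * (φ (γ 1)).toReal
      - l / 2 * (1 - t) * t * dist (γ 0) (γ 1) ^ 2 : ℝ) : EReal)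

/-- `φ` is `l`-convex: any two points of its domain are joined by some minimal geodesic along
which the `l`-convexity inequality holds. -/
def IsSemiConvex {X : Type*} [MetricSpace X] (φ : X → EReal) (l : ℝ) : Prop :=
  ∀ x y : X, φ x ≠ ⊤ → φ y ≠ ⊤ → ∃ γ : ℝ → X, IsMinGeodesic γ x y ∧ ConvexAlong φ l γ

/-- The squared distance from any point is `K`-convex along `γ`. -/
def SqDistConvexAlong {X : Type*} [MetricSpace X] (K : ℝ) (γ : ℝ → X) : Prop :=
  ∀ z : X, ∀ t ∈ Icc (0 : ℝ) 1,
    dist z (γ t) ^ 2 ≤ (1 - t) * dist z (γ 0) ^ 2 + t * dist z (γ 1) ^ 2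
      - K / 2 * (1 - t) * t * dist (γ 0) (γ 1) ^ 2

/-- Commutativity for two geodesics `γ`, `η` issuing from the same point: the one-sided
derivatives at `0` of `d²(γ(s), η(1))` and `d²(η(t), γ(1))` exist and agree. -/
def CommuteAtStart {X : Type*} [MetricSpace X] (γ η : ℝ → X) : Prop :=
  ∃ L : ℝ,
    Tendsto (fun s : ℝ => (dist (γ s) (η 1) ^ 2 - dist (γ 0) (η 1) ^ 2) / s) (𝓝[>] 0) (𝓝 L) ∧
    Tendsto (fun t : ℝ => (dist (η t) (γ 1) ^ 2 - dist (η 0) (γ 1) ^ 2) / t) (𝓝[>] 0) (𝓝 L)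

/-- There is a family `Γ` of minimal geodesics, joining any two points of the domain of `φ`, along
which the commutativity, the `K`-convexity of the squared distance function and the `l`-convexity
of `φ` hold. -/
def HasCommutingGeodesics {X : Type*} [MetricSpace X] (φ : X → EReal) (l K : ℝ) : Prop :=
  ∃ Γ : Set (ℝ → X),
    (∀ γ ∈ Γ, IsMinGeodesic γ (γ 0) (γ 1)) ∧
    (∀ x y : X, φ x ≠ ⊤ → φ y ≠ ⊤ → ∃ γ ∈ Γ, γ 0 = x ∧ γ 1 = y) ∧
    (∀ γ ∈ Γ, ∀ η ∈ Γ, γ 0 = η 0 → CommuteAtStart γ η) ∧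
    (∀ γ ∈ Γ, SqDistConvexAlong K γ) ∧
    (∀ γ ∈ Γ, φ (γ 0) ≠ ⊤ → φ (γ 1) ≠ ⊤ → ConvexAlong φ l γ)

/-- The Moreau–Yosida approximation `φ_τ(x)`. -/
def moreauYosida {X : Type*} [MetricSpace X] (φ : X → EReal) (τ : ℝ) (x : X) : EReal :=
  ⨅ z : X, φ z + ((dist x z ^ 2 / (2 * τ) : ℝ) : EReal)

/-- The set `J_τ^φ(x)` of points attaining the infimum in `φ_τ(x)`. -/
def resolvent {X : Type*} [MetricSpace X] (φ : X → EReal) (τ : ℝ) (x : X) : Set X :=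
  {z | φ z + ((dist x z ^ 2 / (2 * τ) : ℝ) : EReal) = moreauYosida φ τ x}

/-- Coercivity of `φ` with threshold `τs = τ_*(φ) ∈ (0,∞]`. -/
def Coercive {X : Type*} [MetricSpace X] (φ : X → EReal) (τs : ℝ≥0∞) : Prop :=
  0 < τs ∧ ∀ (x : X) (τ : ℝ), 0 < τ → ENNReal.ofReal τ < τs →
    moreauYosida φ τ x ≠ ⊥ ∧ (resolvent φ τ x).Nonempty

/-! ### Discrete solutions and their interpolations -/

/-- A partition `0 = t⁰ < t¹ < ⋯ → ∞` of `[0,∞)`. -/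
structure TimePartition where
  pt : ℕ → ℝ
  pt_zero : pt 0 = 0
  strictMono : StrictMono pt
  tendsto_atTop : Tendsto pt atTop atTop

/-- The mesh `|τ| = sup_k (t^k - t^{k-1}) ∈ [0,∞]`. -/
def TimePartition.mesh (P : TimePartition) : ℝ≥0∞ :=
  ⨆ k : ℕ, ENNReal.ofReal (P.pt (k + 1) - P.pt k)

/-- The least `k` with `t ≤ t^k`. -/
def TimePartition.index (P : TimePartition) (t : ℝ) : ℕ := sInf {k : ℕ | t ≤ P.pt k}

theorem TimePartition.index_of_mem_Ioc (P : TimePartition) {t : ℝ} {k : ℕ}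
    (ht : t ∈ Ioc (P.pt k) (P.pt (k + 1))) : P.index t = k + 1 := by
  apply le_antisymm
  · exact Nat.sInf_le ht.2
  · have hne : {k : ℕ | t ≤ P.pt k}.Nonempty := ⟨k + 1, ht.2⟩
    have hm : t ≤ P.pt (P.index t) := Nat.sInf_mem hne
    exact Nat.succ_le_of_lt (P.strictMono.lt_iff_lt.1 (lt_of_lt_of_le ht.1 hm))

theorem TimePartition.index_zero (P : TimePartition) : P.index 0 = 0 :=
  Nat.le_zero.1 (Nat.sInf_le P.pt_zero.ge)

/-- `x` is a discrete solution from `x₀` associated with the partition `P`. -/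
def IsDiscreteSolution {X : Type*} [MetricSpace X] (φ : X → EReal) (P : TimePartition) (x₀ : X)
    (x : ℕ → X) : Prop :=
  x 0 = x₀ ∧ ∀ k : ℕ, x (k + 1) ∈ resolvent φ (P.pt (k + 1) - P.pt k) (x k)

/-- The interpolated curve: `x^k` for `t ∈ (t^{k-1}, t^k]`, and `x⁰` at `t = 0`. -/
def interp {X : Type*} (P : TimePartition) (x : ℕ → X) (t : ℝ) : X := x (P.index t)

/-- The interpolation of the distances `d(x^k, y)`: for `t ∈ (t^{k-1}, t^k]`, the square root of
`d²(x^{k-1},y) + (t - t^{k-1}) / (t^k - t^{k-1}) * (d²(x^k,y) - d²(x^{k-1},y))`. -/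
def interpDist {X : Type*} [MetricSpace X] (P : TimePartition) (x : ℕ → X) (t : ℝ) (y : X) : ℝ :=
  Real.sqrt (dist (x (P.index t - 1)) y ^ 2 +
    (t - P.pt (P.index t - 1)) / (P.pt (P.index t) - P.pt (P.index t - 1)) *
      (dist (x (P.index t)) y ^ 2 - dist (x (P.index t - 1)) y ^ 2))

theorem interp_zero {X : Type*} (P : TimePartition) (x : ℕ → X) : interp P x 0 = x 0 := by
  rw [interp, P.index_zero]

theorem interp_of_mem_Ioc {X : Type*} (P : TimePartition) (x : ℕ → X) {t : ℝ} {k : ℕ}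
    (ht : t ∈ Ioc (P.pt k) (P.pt (k + 1))) : interp P x t = x (k + 1) := by
  rw [interp, P.index_of_mem_Ioc ht]

theorem interpDist_of_mem_Ioc {X : Type*} [MetricSpace X] (P : TimePartition) (x : ℕ → X) {t : ℝ}
    {k : ℕ} (ht : t ∈ Ioc (P.pt k) (P.pt (k + 1))) (y : X) :
    interpDist P x t y = Real.sqrt (dist (x k) y ^ 2 +
      (t - P.pt k) / (P.pt (k + 1) - P.pt k) * (dist (x (k + 1)) y ^ 2 - dist (x k) y ^ 2)) := by
  simp only [interpDist, P.index_of_mem_Ioc ht, Nat.add_sub_cancel]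

/-! ### Gradient curves and the gradient flow -/

/-- `ξ : [0,∞) → X` (a function on `ℝ` of which only the values on `[0,∞)` matter) is a gradient
curve from `x₀`: the pointwise limit of interpolated discrete solutions from `x₀` associated with
some sequence of partitions whose meshes tend to `0`. -/
def IsGradientCurve {X : Type*} [MetricSpace X] (φ : X → EReal) (x₀ : X) (ξ : ℝ → X) : Prop :=
  ∃ (P : ℕ → TimePartition) (x : ℕ → ℕ → X),
    (∀ i, IsDiscreteSolution φ (P i) x₀ (x i)) ∧
    Tendsto (fun i => (P i).mesh) atTop (𝓝 0) ∧
    ∀ t : ℝ, 0 ≤ t → Tendsto (fun i => interp (P i) (x i) t) atTop (𝓝 (ξ t))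

open Classical in
/-- The gradient flow `𝒢(t, x₀) = ξ(t)`, with `ξ` the gradient curve from `x₀` (and the constant
curve if there is none). -/
def gradientFlow {X : Type*} [MetricSpace X] (φ : X → EReal) (t : ℝ) (x₀ : X) : X :=
  if h : ∃ ξ : ℝ → X, IsGradientCurve φ x₀ ξ then h.choose t else x₀

end MetricGF

end

open Set Filter Topology
open scoped ENNReal

noncomputable section

namespace MetricGF

/-! ### Partitions and piecewise defined functions -/

namespace TimePartition

variable (P Q : TimePartition)

/-! Everything follows from a discrete evolution variational inequality for one resolvent step,
`ResolventIneq φ μ κ` with `μ = -λ` and `κ = -K'`. Minimality of `z ∈ J_τ(x)` along a geodesic from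
`z` to `y` bounds the initial slope of `d²(x, ·)` from below. The geometry of `X` bounds it from
above by `d²(x,y) - d²(z,y) + (κ/2) d²(x,z)`. With commuting geodesics
(`resolventIneq_of_commuting`), the slope equals that of `d²(y, ·)` along the geodesic from `z` to
`x`, where `K`-convexity applies. In a `CAT(1)` space (`resolventIneq_of_isCAT1`), the slope is at
most the spherical first variation, and trigonometry with sides below `π/2` gives the bound with `κ
= 0`.

Given this inequality, two discrete solutions from `x₀` are compared by doubling variables: `d²(x^k,
y^j)` is interpolated linearly in both indices. On a cell of the common refinement its derivative is
a combination of four one-step inequalities. The energy values cancel except for the drops within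
the current steps, so the errors add up to mesh times energy drop. The term `μ d²` is absorbed by an
exponential weight (`cell_antitone`, `sqDistLerp_le`).

Coercivity and a Gronwall argument bound the energy drop on bounded time intervals
(`exists_energy_bound`). Interpolated solutions are then Cauchy as the mesh tends to `0`
(`exists_dist_interp_lt`), which gives existence and uniqueness. Letting one of the two partitions
become infinitely fine and optimizing the free parameter of the weight gives the explicit constant
(`interpDist_sq_le`). -/

theorem pt_nonneg (k : ℕ) : 0 ≤ P.pt k := by
  rw [← P.pt_zero]
  exact P.strictMono.monotone (Nat.zero_le k)

theorem step_pos (k : ℕ) : 0 < P.pt (k + 1) - P.pt k :=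
  sub_pos.2 (P.strictMono (Nat.lt_succ_self k))

theorem exists_mem_Ioc {t : ℝ} (ht : 0 < t) : ∃ k, t ∈ Ioc (P.pt k) (P.pt (k + 1)) := by
  have hex : ∃ k, t ≤ P.pt k := (P.tendsto_atTop.eventually_ge_atTop t).exists
  classical
  obtain ⟨k, hk⟩ : ∃ k, Nat.find hex = k + 1 := by
    refine Nat.exists_eq_succ_of_ne_zero fun h => ?_
    have := Nat.find_spec hex
    rw [h, P.pt_zero] at this
    linarith
  refine ⟨k, not_le.1 (Nat.find_min hex (by omega)), ?_⟩
  rw [← hk]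
  exact Nat.find_spec hex

theorem step_le_mesh (h : P.mesh ≠ ⊤) (k : ℕ) : P.pt (k + 1) - P.pt k ≤ P.mesh.toReal := by
  rw [← ENNReal.ofReal_le_iff_le_toReal h]
  exact le_iSup (fun k : ℕ => ENNReal.ofReal (P.pt (k + 1) - P.pt k)) k

/-- A function that does not increase inside the cells of the common refinement of two partitions
lies below its initial value. -/
theorem le_of_cells (F : ℝ → ℝ)
    (h : ∀ k j r t, P.pt k ≤ r → Q.pt j ≤ r → r ≤ t → t ≤ P.pt (k + 1) → t ≤ Q.pt (j + 1) →
      F t ≤ F r) {t : ℝ} (ht : 0 ≤ t) : F t ≤ F 0 := by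
  have key : ∀ k : ℕ, ∀ t, 0 ≤ t → t ≤ P.pt k → F t ≤ F 0 := by
    intro k
    induction k with
    | zero =>
      intro t h0 h1
      rw [P.pt_zero] at h1
      rw [le_antisymm h1 h0]
    | succ k ihk =>
      have inner : ∀ j : ℕ, ∀ t, P.pt k ≤ t → t ≤ P.pt (k + 1) → t ≤ Q.pt j → F t ≤ F 0 := by
        intro j
        induction j with
        | zero =>
          intro t h0 _ h1
          rw [Q.pt_zero] at h1
          rw [le_antisymm h1 ((P.pt_nonneg k).trans h0)]
        | succ j ihj =>
          intro t h0 h1 h2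
          rcases le_total t (Q.pt j) with h3 | h3
          · exact ihj t h0 h1 h3
          -- The cell starts at the later of its two left nodes; the bound there comes from `ihj` or
          -- `ihk`.
          · rcases le_total (P.pt k) (Q.pt j) with h4 | h4
            · exact (h k j _ t h4 le_rfl h3 h1 h2).trans (ihj _ h4 (h3.trans h1) le_rfl)
            · exact (h k j _ t le_rfl h4 h0 h1 h2).trans (ihk _ (P.pt_nonneg k) le_rfl)
      intro t h0 h1
      rcases le_total t (P.pt k) with h2 | h2
      · exact ihk t h0 h2
      · obtain ⟨j, hj⟩ := (Q.tendsto_atTop.eventually_ge_atTop t).exists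
        exact inner j t h2 h1 hj
  obtain ⟨k, hk⟩ := (P.tendsto_atTop.eventually_ge_atTop t).exists
  exact key k t ht hk

/-- The function given by `f k` on the `k`-th interval of the partition. -/
def glue (f : ℕ → ℝ → ℝ) (t : ℝ) : ℝ := f (P.index t - 1) t

theorem glue_eq {f : ℕ → ℝ → ℝ} (hf : ∀ k, f k (P.pt (k + 1)) = f (k + 1) (P.pt (k + 1)))
    {k : ℕ} {t : ℝ} (ht : t ∈ Icc (P.pt k) (P.pt (k + 1))) : P.glue f t = f k t := by
  rcases ht.1.eq_or_lt with h | h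
  · subst h
    cases k with
    -- At time `0` the truncated subtraction `0 - 1 = 0` selects the first cell.
    | zero => rw [glue, P.pt_zero, P.index_zero]
    | succ k =>
      rw [glue, P.index_of_mem_Ioc (k := k) ⟨P.strictMono (Nat.lt_succ_self k), le_rfl⟩]
      exact hf k
  · rw [glue, P.index_of_mem_Ioc ⟨h, ht.2⟩, Nat.add_sub_cancel]

/-- Piecewise linear interpolation of a sequence. -/
def lerp (c : ℕ → ℝ) : ℝ → ℝ :=
  P.glue fun k t => c k + (t - P.pt k) / (P.pt (k + 1) - P.pt k) * (c (k + 1) - c k)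

theorem lerp_eq (c : ℕ → ℝ) {k : ℕ} {t : ℝ} (ht : t ∈ Icc (P.pt k) (P.pt (k + 1))) :
    P.lerp c t = c k + (t - P.pt k) / (P.pt (k + 1) - P.pt k) * (c (k + 1) - c k) := by
  refine P.glue_eq (fun k => ?_) ht
  rw [div_self (P.step_pos k).ne']
  simp

/-- The accumulated error of a discrete solution along which the function takes the values
`f k`. -/
def errorSum (f : ℕ → ℝ) (a b : ℝ) : ℝ → ℝ :=
  P.glue fun k t =>
    (P.pt (k + 1) - P.pt k) * (f k - f (k + 1)) *
      ((1 - (1 - (t - P.pt k) / (P.pt (k + 1) - P.pt k)) ^ 2)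
        + a * ((t - P.pt k) / (P.pt (k + 1) - P.pt k))
        + b / 3 * (1 - (1 - (t - P.pt k) / (P.pt (k + 1) - P.pt k)) ^ 3))
    + (1 + a + b / 3) * ∑ i ∈ Finset.range k, (P.pt (i + 1) - P.pt i) * (f i - f (i + 1))

theorem errorSum_eq (f : ℕ → ℝ) (a b : ℝ) {k : ℕ} {t : ℝ}
    (ht : t ∈ Icc (P.pt k) (P.pt (k + 1))) :
    P.errorSum f a b t = (P.pt (k + 1) - P.pt k) * (f k - f (k + 1)) *
      ((1 - (1 - (t - P.pt k) / (P.pt (k + 1) - P.pt k)) ^ 2)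
        + a * ((t - P.pt k) / (P.pt (k + 1) - P.pt k))
        + b / 3 * (1 - (1 - (t - P.pt k) / (P.pt (k + 1) - P.pt k)) ^ 3))
    + (1 + a + b / 3) * ∑ i ∈ Finset.range k, (P.pt (i + 1) - P.pt i) * (f i - f (i + 1)) := by
  refine P.glue_eq (f := fun k t => (P.pt (k + 1) - P.pt k) * (f k - f (k + 1)) *
      ((1 - (1 - (t - P.pt k) / (P.pt (k + 1) - P.pt k)) ^ 2)
        + a * ((t - P.pt k) / (P.pt (k + 1) - P.pt k))
        + b / 3 * (1 - (1 - (t - P.pt k) / (P.pt (k + 1) - P.pt k)) ^ 3))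
    + (1 + a + b / 3) * ∑ i ∈ Finset.range k, (P.pt (i + 1) - P.pt i) * (f i - f (i + 1)))
    (fun k => ?_) ht
  -- At the right end of a cell the bracket equals `1 + a + b / 3`, the factor carried by completed
  -- cells, so consecutive pieces match.
  simp only [div_self (P.step_pos k).ne', Finset.sum_range_succ, sub_self, zero_div]
  ring

theorem errorSum_zero (f : ℕ → ℝ) (a b : ℝ) : P.errorSum f a b 0 = 0 := by
  rw [P.errorSum_eq f a b (k := 0) ⟨P.pt_zero.le, P.pt_nonneg 1⟩, P.pt_zero]
  simp

theorem errorSum_le {f : ℕ → ℝ} {a b p : ℝ} (ha : 0 ≤ a) (hb : 0 ≤ b) (hf : Antitone f)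
    (hp : ∀ k, P.pt (k + 1) - P.pt k ≤ p) {k : ℕ} {t : ℝ}
    (ht : t ∈ Icc (P.pt k) (P.pt (k + 1))) :
    P.errorSum f a b t ≤ (1 + a + b / 3) * p * (f 0 - f (k + 1)) := by
  have hs : ∀ n, ∑ i ∈ Finset.range n, (P.pt (i + 1) - P.pt i) * (f i - f (i + 1))
      ≤ p * (f 0 - f n) := by
    intro n
    rw [← Finset.sum_range_sub', Finset.mul_sum]
    exact Finset.sum_le_sum fun i _ =>
      mul_le_mul_of_nonneg_right (hp i) (sub_nonneg.2 (hf (Nat.le_succ i)))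
  have h1 := hs (k + 1)
  rw [Finset.sum_range_succ] at h1
  rw [P.errorSum_eq f a b ht]
  set w := (t - P.pt k) / (P.pt (k + 1) - P.pt k) with hw
  have hw0 : 0 ≤ w := div_nonneg (sub_nonneg.2 ht.1) (P.step_pos k).le
  have hw1 : w ≤ 1 := (div_le_one (P.step_pos k)).2 (by linarith [ht.2])
  have h2 : 0 ≤ (P.pt (k + 1) - P.pt k) * (f k - f (k + 1)) :=
    mul_nonneg (P.step_pos k).le (sub_nonneg.2 (hf (Nat.le_succ k)))
  have h3 : (1 - (1 - w) ^ 2) + a * w + b / 3 * (1 - (1 - w) ^ 3) ≤ 1 + a + b / 3 := by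
    have e1 : a * w ≤ a := mul_le_of_le_one_right ha hw1
    have e2 : b / 3 * (1 - (1 - w) ^ 3) ≤ b / 3 :=
      mul_le_of_le_one_right (by positivity) (by linarith [pow_nonneg (sub_nonneg.2 hw1) 3])
    nlinarith [sq_nonneg (1 - w)]
  have h4 := mul_le_mul_of_nonneg_left h3 h2
  have h5 : 0 ≤ 1 + a + b / 3 := by positivity
  have h6 := mul_le_mul_of_nonneg_left h1 h5
  nlinarith

end TimePartition

/-! ### Discrete solutions -/

section Resolvent

variable {X : Type*} [MetricSpace X] {φ : X → EReal}

theorem resolvent_ne_top {τ : ℝ} {x z : X} (hx : φ x ≠ ⊤) (hz : z ∈ resolvent φ τ x) :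
    φ z ≠ ⊤ := by
  intro h
  have h1 : φ z + ((dist x z ^ 2 / (2 * τ) : ℝ) : EReal) ≤
      φ x + ((dist x x ^ 2 / (2 * τ) : ℝ) : EReal) := by
    rw [show φ z + _ = moreauYosida φ τ x from hz]
    exact iInf_le _ x
  rw [h, EReal.top_add_coe, top_le_iff, dist_self] at h1
  simp at h1
  exact hx h1

theorem resolvent_le (hbot : ∀ x, φ x ≠ ⊥) {τ : ℝ} {x z w : X} (hx : φ x ≠ ⊤)
    (hz : z ∈ resolvent φ τ x) {r : ℝ} (hw : φ w ≤ (r : EReal)) :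
    (φ z).toReal + dist x z ^ 2 / (2 * τ) ≤ r + dist x w ^ 2 / (2 * τ) := by
  have h1 : φ z + ((dist x z ^ 2 / (2 * τ) : ℝ) : EReal) ≤
      φ w + ((dist x w ^ 2 / (2 * τ) : ℝ) : EReal) := by
    rw [show φ z + _ = moreauYosida φ τ x from hz]
    exact iInf_le _ w
  have h2 := h1.trans (add_le_add_left hw _)
  rw [← EReal.coe_toReal (resolvent_ne_top hx hz) (hbot z)] at h2
  exact_mod_cast h2

theorem sq_dist_resolvent_le (hbot : ∀ x, φ x ≠ ⊥) {τ : ℝ} (hτ : 0 < τ) {x z : X} (hx : φ x ≠ ⊤)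
    (hz : z ∈ resolvent φ τ x) :
    dist x z ^ 2 ≤ 2 * τ * ((φ x).toReal - (φ z).toReal) := by
  have h := resolvent_le hbot hx hz (w := x) (r := (φ x).toReal)
    (EReal.coe_toReal hx (hbot x)).ge
  rw [dist_self] at h
  have h2 : dist x z ^ 2 / (2 * τ) ≤ (φ x).toReal - (φ z).toReal := by
    simp at h
    linarith
  rw [div_le_iff₀ (by positivity)] at h2
  linarith

/-- The discrete evolution variational inequality for one step of the resolvent. -/
def ResolventIneq (φ : X → EReal) (μ κ : ℝ) : Prop :=
  ∀ (τ : ℝ) (x z y : X), 0 < τ → φ x ≠ ⊤ → φ y ≠ ⊤ → z ∈ resolvent φ τ x →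
    dist z y ^ 2 ≤ dist x y ^ 2 + κ / 2 * dist x z ^ 2
      + 2 * τ * ((φ y).toReal - (φ z).toReal) + μ * τ * dist z y ^ 2

variable {P : TimePartition} {x₀ : X} {x : ℕ → X}

theorem IsDiscreteSolution.ne_top (h : IsDiscreteSolution φ P x₀ x) (hx₀ : φ x₀ ≠ ⊤) (k : ℕ) :
    φ (x k) ≠ ⊤ := by
  induction k with
  | zero => rwa [h.1]
  | succ k ih => exact resolvent_ne_top ih (h.2 k)

theorem IsDiscreteSolution.sq_dist_le (hbot : ∀ x, φ x ≠ ⊥) (h : IsDiscreteSolution φ P x₀ x)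
    (hx₀ : φ x₀ ≠ ⊤) (k : ℕ) :
    dist (x k) (x (k + 1)) ^ 2 ≤
      2 * (P.pt (k + 1) - P.pt k) * ((φ (x k)).toReal - (φ (x (k + 1))).toReal) :=
  sq_dist_resolvent_le hbot (P.step_pos k) (h.ne_top hx₀ k) (h.2 k)

theorem IsDiscreteSolution.antitone (hbot : ∀ x, φ x ≠ ⊥) (h : IsDiscreteSolution φ P x₀ x)
    (hx₀ : φ x₀ ≠ ⊤) : Antitone fun k => (φ (x k)).toReal := by
  refine antitone_nat_of_succ_le fun k => ?_
  have h1 := (sq_nonneg _).trans (h.sq_dist_le hbot hx₀ k)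
  have h2 := P.step_pos k
  by_contra hc
  nlinarith [not_le.1 hc]

end Resolvent

/-! ### Comparison of two discrete solutions -/

/-- The one-step inequality produces `μ b²` at the end of the step, whereas a differential
inequality needs the interpolated value at weight `w`. The two are related by `b ≤ ((1-w)a + wb) +
(1-w)D` and Young's inequality with parameter `k`; the excess is paid for by `D² ≤ 2τΔ`, that is, by
the energy drop. -/
theorem evi_slope_le {τ a b D κ μ ψ φ₁ Δ p w k : ℝ} (hτ : 0 < τ) (hb0 : 0 ≤ b) (hκ : 0 ≤ κ)
    (hμ : 0 ≤ μ) (hab : b ≤ a + D)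
    (hev : b ^ 2 ≤ a ^ 2 + κ / 2 * D ^ 2 + 2 * τ * (ψ - φ₁) + μ * τ * b ^ 2)
    (hD : D ^ 2 ≤ 2 * τ * Δ) (hp : τ ≤ p) (hw0 : 0 ≤ w) (hw1 : w ≤ 1) (hk : 0 < k) :
    (b ^ 2 - a ^ 2) / τ ≤ 2 * (ψ - φ₁) + κ * Δ
      + μ * (1 + 1 / k) * ((1 - w) * a ^ 2 + w * b ^ 2)
      + (1 + k) * (2 * p * μ) * (1 - w) ^ 2 * Δ := by
  have hΔ : 0 ≤ Δ := (mul_nonneg_iff_of_pos_left (by positivity)).1 ((sq_nonneg D).trans hD)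
  have h1 : b ≤ ((1 - w) * a + w * b) + (1 - w) * D := by nlinarith
  have h2 : b ^ 2 ≤ (1 + 1 / k) * ((1 - w) * a + w * b) ^ 2 + (1 + k) * ((1 - w) * D) ^ 2 := by
    have e1 : b ^ 2 ≤ (((1 - w) * a + w * b) + (1 - w) * D) ^ 2 := pow_le_pow_left₀ hb0 h1 2
    have e2 : 0 ≤ 1 / k * (((1 - w) * a + w * b) - k * ((1 - w) * D)) ^ 2 := by positivity
    have e3 : 1 / k * (((1 - w) * a + w * b) - k * ((1 - w) * D)) ^ 2 =
        1 / k * ((1 - w) * a + w * b) ^ 2 - 2 * ((1 - w) * a + w * b) * ((1 - w) * D)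
          + k * ((1 - w) * D) ^ 2 := by
      field_simp
      ring
    nlinarith
  have h3 : ((1 - w) * a + w * b) ^ 2 ≤ (1 - w) * a ^ 2 + w * b ^ 2 := by
    nlinarith [mul_nonneg (mul_nonneg hw0 (sub_nonneg.2 hw1)) (sq_nonneg (a - b))]
  have h4 : D ^ 2 ≤ 2 * p * Δ := by nlinarith
  have h5 : ((1 - w) * D) ^ 2 ≤ (1 - w) ^ 2 * (2 * p * Δ) := by
    rw [mul_pow]
    exact mul_le_mul_of_nonneg_left h4 (sq_nonneg _)
  have h6 : b ^ 2 ≤ (1 + 1 / k) * ((1 - w) * a ^ 2 + w * b ^ 2)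
      + (1 + k) * ((1 - w) ^ 2 * (2 * p * Δ)) := by
    have e1 : 0 ≤ 1 + 1 / k := by positivity
    have e2 : 0 ≤ 1 + k := by positivity
    linarith [mul_le_mul_of_nonneg_left h3 e1, mul_le_mul_of_nonneg_left h5 e2]
  have h7 := mul_le_mul_of_nonneg_left h6 hμ
  have h8 : (b ^ 2 - a ^ 2) / τ ≤ 2 * (ψ - φ₁) + κ * Δ + μ * b ^ 2 := by
    rw [div_le_iff₀ hτ]
    nlinarith
  linarith

/-- This is what dictates the form of `errorSum`: on each cell it is a primitive of the residual
terms left over by `evi_slope_le`. -/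
theorem hasDerivAt_error_term {τ : ℝ} (hτ : τ ≠ 0) (s Δ κ B S t : ℝ) :
    HasDerivAt (fun t => τ * Δ * ((1 - (1 - (t - s) / τ) ^ 2) + κ * ((t - s) / τ)
        + B / 3 * (1 - (1 - (t - s) / τ) ^ 3)) + S)
      (Δ * (2 * (1 - (t - s) / τ) + κ + B * (1 - (t - s) / τ) ^ 2)) t := by
  have hw : HasDerivAt (fun t => (t - s) / τ) (1 / τ) t :=
    ((hasDerivAt_id t).sub_const s).div_const τ
  have h := ((((((hw.const_sub 1).pow 2).const_sub 1).add (hw.const_mul κ)).add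
    ((((hw.const_sub 1).pow 3).const_sub 1).const_mul (B / 3))).const_mul (τ * Δ)).add_const S
  refine h.congr_deriv ?_
  rw [show ∀ z : ℝ, τ * Δ * z = Δ * (τ * z) by intro z; ring]
  congr 1
  set w := (t - s) / τ
  have h1 : τ * (1 / τ) = 1 := mul_one_div_cancel hτ
  norm_num
  linear_combination (2 * (1 - w) + κ + B * (1 - w) ^ 2) * h1

/-- Inside a cell of the common refinement, the weighted interpolated squared distance minus the
accumulated errors does not increase; `d00, d10, d01, d11` are the distances between consecutive
points of the two discrete solutions. -/
theorem cell_antitone {s s' τ η d00 d10 d01 d11 D D' κ μ φ0 φ1 ψ0 ψ1 p q c c' S S' : ℝ}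
    (hτ : 0 < τ) (hη : 0 < η) (h10 : 0 ≤ d10) (h01 : 0 ≤ d01) (h11 : 0 ≤ d11)
    (hκ : 0 ≤ κ) (hμ : 0 ≤ μ) (hc : 0 < c) (hc' : 0 < c') (hp : τ ≤ p) (hq : η ≤ q)
    (hD : D ^ 2 ≤ 2 * τ * (φ0 - φ1)) (hD' : D' ^ 2 ≤ 2 * η * (ψ0 - ψ1))
    (hx0 : d10 ≤ d00 + D) (hx1 : d11 ≤ d01 + D) (hy0 : d01 ≤ d00 + D') (hy1 : d11 ≤ d10 + D')
    (ex0 : d10 ^ 2 ≤ d00 ^ 2 + κ / 2 * D ^ 2 + 2 * τ * (ψ0 - φ1) + μ * τ * d10 ^ 2)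
    (ex1 : d11 ^ 2 ≤ d01 ^ 2 + κ / 2 * D ^ 2 + 2 * τ * (ψ1 - φ1) + μ * τ * d11 ^ 2)
    (ey0 : d01 ^ 2 ≤ d00 ^ 2 + κ / 2 * D' ^ 2 + 2 * η * (φ0 - ψ1) + μ * η * d01 ^ 2)
    (ey1 : d11 ^ 2 ≤ d10 ^ 2 + κ / 2 * D' ^ 2 + 2 * η * (φ1 - ψ1) + μ * η * d11 ^ 2)
    {r t : ℝ} (hr0 : 0 ≤ r) (hsr : s ≤ r) (hsr' : s' ≤ r) (ht : t ≤ s + τ)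
    (ht' : t ≤ s' + η) :
    AntitoneOn (fun t => Real.exp (-2 * μ * t - (c + c') * (1 - Real.exp (-2 * μ * t))) *
        ((d00 ^ 2 + (t - s') / η * (d01 ^ 2 - d00 ^ 2)) + (t - s) / τ *
          ((d10 ^ 2 + (t - s') / η * (d11 ^ 2 - d10 ^ 2))
            - (d00 ^ 2 + (t - s') / η * (d01 ^ 2 - d00 ^ 2))))
      - (τ * (φ0 - φ1) * ((1 - (1 - (t - s) / τ) ^ 2) + κ * ((t - s) / τ)
          + ((1 + 1 / (2 * c)) * (2 * p * μ)) / 3 * (1 - (1 - (t - s) / τ) ^ 3)) + S)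
      - (η * (ψ0 - ψ1) * ((1 - (1 - (t - s') / η) ^ 2) + κ * ((t - s') / η)
          + ((1 + 1 / (2 * c')) * (2 * q * μ)) / 3 * (1 - (1 - (t - s') / η) ^ 3)) + S'))
      (Icc r t) := by
  have hder : ∀ t : ℝ, HasDerivAt
      (fun t => Real.exp (-2 * μ * t - (c + c') * (1 - Real.exp (-2 * μ * t))) *
        ((d00 ^ 2 + (t - s') / η * (d01 ^ 2 - d00 ^ 2)) + (t - s) / τ *
          ((d10 ^ 2 + (t - s') / η * (d11 ^ 2 - d10 ^ 2))
            - (d00 ^ 2 + (t - s') / η * (d01 ^ 2 - d00 ^ 2))))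
      - (τ * (φ0 - φ1) * ((1 - (1 - (t - s) / τ) ^ 2) + κ * ((t - s) / τ)
          + ((1 + 1 / (2 * c)) * (2 * p * μ)) / 3 * (1 - (1 - (t - s) / τ) ^ 3)) + S)
      - (η * (ψ0 - ψ1) * ((1 - (1 - (t - s') / η) ^ 2) + κ * ((t - s') / η)
          + ((1 + 1 / (2 * c')) * (2 * q * μ)) / 3 * (1 - (1 - (t - s') / η) ^ 3)) + S'))
      (Real.exp (-2 * μ * t - (c + c') * (1 - Real.exp (-2 * μ * t))) *
        (-(2 * μ + (c + c') * (2 * μ * Real.exp (-2 * μ * t))) *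
        ((d00 ^ 2 + (t - s') / η * (d01 ^ 2 - d00 ^ 2)) + (t - s) / τ *
          ((d10 ^ 2 + (t - s') / η * (d11 ^ 2 - d10 ^ 2))
            - (d00 ^ 2 + (t - s') / η * (d01 ^ 2 - d00 ^ 2))))
        + ((1 - (t - s') / η) * ((d10 ^ 2 - d00 ^ 2) / τ)
            + (t - s') / η * ((d11 ^ 2 - d01 ^ 2) / τ)
            + (1 - (t - s) / τ) * ((d01 ^ 2 - d00 ^ 2) / η)
            + (t - s) / τ * ((d11 ^ 2 - d10 ^ 2) / η)))
      - (φ0 - φ1) * (2 * (1 - (t - s) / τ) + κ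
          + (1 + 1 / (2 * c)) * (2 * p * μ) * (1 - (t - s) / τ) ^ 2)
      - (ψ0 - ψ1) * (2 * (1 - (t - s') / η) + κ
          + (1 + 1 / (2 * c')) * (2 * q * μ) * (1 - (t - s') / η) ^ 2)) t := by
    intro t
    have hw : HasDerivAt (fun t => (t - s) / τ) (1 / τ) t :=
      ((hasDerivAt_id t).sub_const s).div_const τ
    have hm : HasDerivAt (fun t => (t - s') / η) (1 / η) t :=
      ((hasDerivAt_id t).sub_const s').div_const η
    have hl : HasDerivAt (fun t : ℝ => -2 * μ * t) (-2 * μ) t := by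
      simpa using (hasDerivAt_id t).const_mul (-2 * μ)
    have hE := (hl.sub ((hl.exp.const_sub 1).const_mul (c + c'))).exp
    have hB0 := (hm.mul_const (d01 ^ 2 - d00 ^ 2)).const_add (d00 ^ 2)
    have hB1 := (hm.mul_const (d11 ^ 2 - d10 ^ 2)).const_add (d10 ^ 2)
    have hq := hB0.add (hw.mul (hB1.sub hB0))
    have h := ((hE.mul hq).sub (hasDerivAt_error_term hτ.ne' s (φ0 - φ1) κ
      ((1 + 1 / (2 * c)) * (2 * p * μ)) S t)).sub (hasDerivAt_error_term hη.ne' s' (ψ0 - ψ1) κ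
      ((1 + 1 / (2 * c')) * (2 * q * μ)) S' t)
    refine h.congr_deriv ?_
    congr 2
    simp only [Pi.sub_apply, Pi.add_apply, Pi.mul_apply]
    ring
  refine antitoneOn_of_hasDerivWithinAt_nonpos (convex_Icc r t)
    (fun u _ => (hder u).continuousAt.continuousWithinAt)
    (fun u _ => (hder u).hasDerivWithinAt) fun u hu => ?_
  rw [interior_Icc] at hu
  have hu0 : 0 ≤ u := hr0.trans hu.1.le
  set w := (u - s) / τ with hw
  set m := (u - s') / η with hm
  have hw0 : 0 ≤ w := div_nonneg (by linarith [hu.1]) hτ.le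
  have hw1 : w ≤ 1 := (div_le_one hτ).2 (by linarith [hu.2])
  have hm0 : 0 ≤ m := div_nonneg (by linarith [hu.1]) hη.le
  have hm1 : m ≤ 1 := (div_le_one hη).2 (by linarith [hu.2])
  set e := Real.exp (-2 * μ * u) with he
  have he0 : 0 < e := Real.exp_pos _
  have he1 : e ≤ 1 := Real.exp_le_one_iff.2 (by linarith [mul_nonneg hμ hu0])
  set E := Real.exp (-2 * μ * u - (c + c') * (1 - e)) with hE
  have hE0 : 0 < E := Real.exp_pos _
  have hEe : E ≤ e :=
    Real.exp_le_exp.2 (by linarith [mul_nonneg (add_pos hc hc').le (sub_nonneg.2 he1)])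
  have hE1 : E ≤ 1 := hEe.trans he1
  -- The Young parameters are `1 / (2ce)` and `1 / (2c'e)`, which depend on time through `e = exp
  -- (-2μu)`. The extra growth rate `2μ(c + c')e` is then exactly the derivative of the correction
  -- `(c + c')(1 - e)` in the weight, which stays bounded for all times. The price, a factor `1/e`
  -- in the error, is absorbed by `E ≤ e`.
  have hEk : ∀ c : ℝ, 0 < c → E * (1 + 1 / (2 * c * e)) ≤ 1 + 1 / (2 * c) := by
    intro c hc
    have : E * (1 / (2 * c * e)) ≤ 1 / (2 * c) := by
      rw [mul_one_div, div_le_div_iff₀ (by positivity) (by positivity), one_mul, mul_comm]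
      exact mul_le_mul_of_nonneg_left hEe (by positivity)
    linarith
  have hΔ : 0 ≤ φ0 - φ1 :=
    (mul_nonneg_iff_of_pos_left (by positivity)).1 ((sq_nonneg D).trans hD)
  have hΔ' : 0 ≤ ψ0 - ψ1 :=
    (mul_nonneg_iff_of_pos_left (by positivity)).1 ((sq_nonneg D').trans hD')
  have hkx : 0 < 1 / (2 * c * e) := by positivity
  have hky : 0 < 1 / (2 * c' * e) := by positivity
  have i1 := evi_slope_le hτ h10 hκ hμ hx0 ex0 hD hp hw0 hw1 hkx
  have i2 := evi_slope_le hτ h11 hκ hμ hx1 ex1 hD hp hw0 hw1 hkx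
  have i3 := evi_slope_le hη h01 hκ hμ hy0 ey0 hD' hq hm0 hm1 hky
  have i4 := evi_slope_le hη h11 hκ hμ hy1 ey1 hD' hq hm0 hm1 hky
  have j1 := mul_le_mul_of_nonneg_left i1 (sub_nonneg.2 hm1)
  have j2 := mul_le_mul_of_nonneg_left i2 hm0
  have j3 := mul_le_mul_of_nonneg_left i3 (sub_nonneg.2 hw1)
  have j4 := mul_le_mul_of_nonneg_left i4 hw0
  rw [one_div_one_div] at j1 j2 j3 j4
  -- In the average of the four slopes the energies enter as `2((1-m)ψ0 + mψ1 - φ1) + 2((1-w)φ0 +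
  -- wφ1 - ψ1)`, which collapses to `2(1-m)(ψ0-ψ1) + 2(1-w)(φ0-φ1)`.
  have hsum : -(2 * μ + (c + c') * (2 * μ * e)) *
        ((d00 ^ 2 + m * (d01 ^ 2 - d00 ^ 2)) + w *
          ((d10 ^ 2 + m * (d11 ^ 2 - d10 ^ 2)) - (d00 ^ 2 + m * (d01 ^ 2 - d00 ^ 2))))
        + ((1 - m) * ((d10 ^ 2 - d00 ^ 2) / τ) + m * ((d11 ^ 2 - d01 ^ 2) / τ)
            + (1 - w) * ((d01 ^ 2 - d00 ^ 2) / η) + w * ((d11 ^ 2 - d10 ^ 2) / η)) ≤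
      (2 * (1 - w) + κ) * (φ0 - φ1)
        + (1 + 1 / (2 * c * e)) * (2 * p * μ * (1 - w) ^ 2 * (φ0 - φ1))
      + ((2 * (1 - m) + κ) * (ψ0 - ψ1)
        + (1 + 1 / (2 * c' * e)) * (2 * q * μ * (1 - m) ^ 2 * (ψ0 - ψ1))) := by
    refine (add_le_add_right (add_le_add (add_le_add (add_le_add j1 j2) j3) j4) _).trans
      (le_of_eq ?_)
    ring
  have hmul := mul_le_mul_of_nonneg_left hsum hE0.le
  have k1 : E * ((2 * (1 - w) + κ) * (φ0 - φ1)) ≤ (2 * (1 - w) + κ) * (φ0 - φ1) :=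
    mul_le_of_le_one_left (mul_nonneg (by linarith) hΔ) hE1
  have k2 : E * ((2 * (1 - m) + κ) * (ψ0 - ψ1)) ≤ (2 * (1 - m) + κ) * (ψ0 - ψ1) :=
    mul_le_of_le_one_left (mul_nonneg (by linarith) hΔ') hE1
  have hp0 : 0 ≤ p := hτ.le.trans hp
  have hq0 : 0 ≤ q := hη.le.trans hq
  have k3 := mul_le_mul_of_nonneg_right (hEk c hc)
    (show 0 ≤ 2 * p * μ * (1 - w) ^ 2 * (φ0 - φ1) by positivity)
  have k4 := mul_le_mul_of_nonneg_right (hEk c' hc')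
    (show 0 ≤ 2 * q * μ * (1 - m) ^ 2 * (ψ0 - ψ1) by positivity)
  clear_value E e w m
  clear i1 i2 i3 i4 j1 j2 j3 j4 hsum hx0 hx1 hy0 hy1 ex0 ex1 ey0 ey1 hD hD' hder hEk
  linarith

section Comparison

variable {X : Type*} [MetricSpace X] {φ : X → EReal}

/-- The squared distance of two discrete solutions, interpolated in both variables. -/
def sqDistLerp (P Q : TimePartition) (x y : ℕ → X) (t : ℝ) : ℝ :=
  P.lerp (fun k => Q.lerp (fun j => dist (x k) (y j) ^ 2) t) t

theorem sqDistLerp_eq {P Q : TimePartition} (x y : ℕ → X) {k j : ℕ} {t : ℝ}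
    (hk : t ∈ Icc (P.pt k) (P.pt (k + 1))) (hj : t ∈ Icc (Q.pt j) (Q.pt (j + 1))) :
    sqDistLerp P Q x y t =
      (dist (x k) (y j) ^ 2 + (t - Q.pt j) / (Q.pt (j + 1) - Q.pt j) *
          (dist (x k) (y (j + 1)) ^ 2 - dist (x k) (y j) ^ 2))
      + (t - P.pt k) / (P.pt (k + 1) - P.pt k) *
        ((dist (x (k + 1)) (y j) ^ 2 + (t - Q.pt j) / (Q.pt (j + 1) - Q.pt j) *
            (dist (x (k + 1)) (y (j + 1)) ^ 2 - dist (x (k + 1)) (y j) ^ 2))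
        - (dist (x k) (y j) ^ 2 + (t - Q.pt j) / (Q.pt (j + 1) - Q.pt j) *
            (dist (x k) (y (j + 1)) ^ 2 - dist (x k) (y j) ^ 2))) := by
  simp only [sqDistLerp, P.lerp_eq _ hk, Q.lerp_eq _ hj]

/-- Comparison of two discrete solutions issuing from the same point. -/
theorem sqDistLerp_le (hbot : ∀ x, φ x ≠ ⊥) {μ κ : ℝ} (hμ : 0 ≤ μ) (hκ : 0 ≤ κ)
    (hres : ResolventIneq φ μ κ) {x₀ : X} (hx₀ : φ x₀ ≠ ⊤) {P Q : TimePartition} {x y : ℕ → X}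
    (hx : IsDiscreteSolution φ P x₀ x) (hy : IsDiscreteSolution φ Q x₀ y) {p q c c' t : ℝ}
    (hp : ∀ k, P.pt (k + 1) - P.pt k ≤ p) (hq : ∀ k, Q.pt (k + 1) - Q.pt k ≤ q)
    (hc : 0 < c) (hc' : 0 < c') (ht : 0 < t) :
    Real.exp (-2 * μ * t) * sqDistLerp P Q x y t ≤ Real.exp (c + c') *
      ((1 + κ + (1 + 1 / (2 * c)) * (2 * p * μ) / 3) * p *
          ((φ x₀).toReal - (φ (interp P x t)).toReal)
        + (1 + κ + (1 + 1 / (2 * c')) * (2 * q * μ) / 3) * q *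
          ((φ x₀).toReal - (φ (interp Q y t)).toReal)) := by
  set f : ℕ → ℝ := fun k => (φ (x k)).toReal with hf
  set g : ℕ → ℝ := fun k => (φ (y k)).toReal with hg
  set F : ℝ → ℝ := fun t =>
    Real.exp (-2 * μ * t - (c + c') * (1 - Real.exp (-2 * μ * t))) * sqDistLerp P Q x y t
      - P.errorSum f κ ((1 + 1 / (2 * c)) * (2 * p * μ)) t
      - Q.errorSum g κ ((1 + 1 / (2 * c')) * (2 * q * μ)) t with hF
  have hp0 : 0 ≤ p := (P.step_pos 0).le.trans (hp 0)
  have hq0 : 0 ≤ q := (Q.step_pos 0).le.trans (hq 0)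
  have hF0 : F 0 = 0 := by
    have h0 : sqDistLerp P Q x y 0 = 0 := by
      rw [sqDistLerp_eq x y (k := 0) (j := 0) ⟨P.pt_zero.le, P.pt_nonneg 1⟩
        ⟨Q.pt_zero.le, Q.pt_nonneg 1⟩, P.pt_zero, Q.pt_zero, hx.1, hy.1]
      simp
    simp only [hF, h0, P.errorSum_zero, Q.errorSum_zero]
    ring
  have hFt : F t ≤ F 0 := by
    refine P.le_of_cells Q F (fun k j r t hk hj hrt hk' hj' => ?_) ht.le
    have key := cell_antitone (s := P.pt k) (s' := Q.pt j) (P.step_pos k) (Q.step_pos j)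
      (dist_nonneg (x := x (k + 1)) (y := y j))
      (dist_nonneg (x := x k) (y := y (j + 1))) (dist_nonneg (x := x (k + 1)) (y := y (j + 1)))
      hκ hμ hc hc' (hp k) (hq j) (hx.sq_dist_le hbot hx₀ k) (hy.sq_dist_le hbot hx₀ j)
      ((dist_triangle_left _ _ _).trans_eq (add_comm _ _))
      ((dist_triangle_left _ _ _).trans_eq (add_comm _ _))
      (dist_triangle _ _ _) (dist_triangle _ _ _)
      (hres _ _ _ _ (P.step_pos k) (hx.ne_top hx₀ k) (hy.ne_top hx₀ j) (hx.2 k))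
      (hres _ _ _ _ (P.step_pos k) (hx.ne_top hx₀ k) (hy.ne_top hx₀ (j + 1)) (hx.2 k))
      (by
        rw [dist_comm (x k) (y (j + 1)), dist_comm (x k) (y j)]
        exact hres _ _ _ _ (Q.step_pos j) (hy.ne_top hx₀ j) (hx.ne_top hx₀ k) (hy.2 j))
      (by
        rw [dist_comm (x (k + 1)) (y (j + 1)), dist_comm (x (k + 1)) (y j)]
        exact hres _ _ _ _ (Q.step_pos j) (hy.ne_top hx₀ j) (hx.ne_top hx₀ (k + 1)) (hy.2 j))
      (S := (1 + κ + (1 + 1 / (2 * c)) * (2 * p * μ) / 3) *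
        ∑ i ∈ Finset.range k, (P.pt (i + 1) - P.pt i) * (f i - f (i + 1)))
      (S' := (1 + κ + (1 + 1 / (2 * c')) * (2 * q * μ) / 3) *
        ∑ i ∈ Finset.range j, (Q.pt (i + 1) - Q.pt i) * (g i - g (i + 1)))
      (t := t) ((P.pt_nonneg k).trans hk) hk hj (by linarith) (by linarith)
    have := key (left_mem_Icc.2 hrt) (right_mem_Icc.2 hrt) hrt
    have hrk : r ∈ Icc (P.pt k) (P.pt (k + 1)) := ⟨hk, hrt.trans hk'⟩
    have hrj : r ∈ Icc (Q.pt j) (Q.pt (j + 1)) := ⟨hj, hrt.trans hj'⟩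
    have htk : t ∈ Icc (P.pt k) (P.pt (k + 1)) := ⟨hk.trans hrt, hk'⟩
    have htj : t ∈ Icc (Q.pt j) (Q.pt (j + 1)) := ⟨hj.trans hrt, hj'⟩
    simp only [hF, sqDistLerp_eq x y htk htj, sqDistLerp_eq x y hrk hrj, P.errorSum_eq f _ _ htk,
      P.errorSum_eq f _ _ hrk, Q.errorSum_eq g _ _ htj, Q.errorSum_eq g _ _ hrj]
    exact this
  obtain ⟨k, hk⟩ := P.exists_mem_Ioc ht
  obtain ⟨j, hj⟩ := Q.exists_mem_Ioc ht
  have e1 := P.errorSum_le hκ (b := (1 + 1 / (2 * c)) * (2 * p * μ)) (by positivity)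
    (hx.antitone hbot hx₀) hp (Ioc_subset_Icc_self hk)
  have e2 := Q.errorSum_le hκ (b := (1 + 1 / (2 * c')) * (2 * q * μ)) (by positivity)
    (hy.antitone hbot hx₀) hq (Ioc_subset_Icc_self hj)
  rw [interp_of_mem_Ioc P x hk, interp_of_mem_Ioc Q y hj]
  simp only [hx.1, hy.1] at e1 e2
  rw [hF0] at hFt
  simp only [hF, sub_nonpos] at hFt
  have hle : Real.exp (-2 * μ * t - (c + c') * (1 - Real.exp (-2 * μ * t))) *
      sqDistLerp P Q x y t ≤
      ((1 + κ + (1 + 1 / (2 * c)) * (2 * p * μ) / 3) * p *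
          ((φ x₀).toReal - (φ (x (k + 1))).toReal)
        + (1 + κ + (1 + 1 / (2 * c')) * (2 * q * μ) / 3) * q *
          ((φ x₀).toReal - (φ (y (j + 1))).toReal)) := by
    linarith
  have hA := (mul_nonneg (mul_nonneg (show (0 : ℝ) ≤ 1 + κ + (1 + 1 / (2 * c)) * (2 * p * μ) / 3 by
    positivity) hp0) (sub_nonneg.2 (hx.antitone hbot hx₀ (Nat.zero_le (k + 1)))))
  have hB := (mul_nonneg (mul_nonneg (show (0 : ℝ) ≤ 1 + κ + (1 + 1 / (2 * c')) * (2 * q * μ) / 3 by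
    positivity) hq0) (sub_nonneg.2 (hy.antitone hbot hx₀ (Nat.zero_le (j + 1)))))
  simp only [hx.1, hy.1] at hA hB
  -- Replacing the corrected weight by `exp (-2μt)` costs at most `exp (c + c')`, uniformly in time.
  have hsplit : Real.exp (-2 * μ * t) = Real.exp ((c + c') * (1 - Real.exp (-2 * μ * t))) *
      Real.exp (-2 * μ * t - (c + c') * (1 - Real.exp (-2 * μ * t))) := by
    rw [← Real.exp_add]
    ring_nf
  rw [hsplit, mul_assoc]
  refine mul_le_mul (Real.exp_le_exp.2 ?_) hle ?_ (Real.exp_pos _).le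
  · nlinarith [Real.exp_pos (-2 * μ * t)]
  · refine mul_nonneg (Real.exp_pos _).le ?_
    rw [sqDistLerp_eq x y (Ioc_subset_Icc_self hk) (Ioc_subset_Icc_self hj)]
    set w := (t - P.pt k) / (P.pt (k + 1) - P.pt k) with hw
    set m := (t - Q.pt j) / (Q.pt (j + 1) - Q.pt j) with hm
    have hw0 : 0 ≤ w := div_nonneg (by linarith [hk.1]) (P.step_pos k).le
    have hw1 : w ≤ 1 := (div_le_one (P.step_pos k)).2 (by linarith [hk.2])
    have hm0 : 0 ≤ m := div_nonneg (by linarith [hj.1]) (Q.step_pos j).le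
    have hm1 : m ≤ 1 := (div_le_one (Q.step_pos j)).2 (by linarith [hj.2])
    have hw2 := sub_nonneg.2 hw1
    have hm2 := sub_nonneg.2 hm1
    have : 0 ≤ (1 - w) * ((1 - m) * dist (x k) (y j) ^ 2 + m * dist (x k) (y (j + 1)) ^ 2)
      + w * ((1 - m) * dist (x (k + 1)) (y j) ^ 2 + m * dist (x (k + 1)) (y (j + 1)) ^ 2) := by
      positivity
    linarith

end Comparison

/-! ### The one-step estimate -/

section OneStep

variable {X : Type*} [MetricSpace X] {φ : X → EReal}

/-- First order optimality of a point of the resolvent along a geodesic issuing from it. -/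
theorem le_slope_of_mem_resolvent (hbot : ∀ x, φ x ≠ ⊥) {τ l : ℝ} (hτ : 0 < τ) {x z y : X}
    (hx : φ x ≠ ⊤) (hz : z ∈ resolvent φ τ x) {γ : ℝ → X} (hγ : IsMinGeodesic γ z y)
    (hφ : ConvexAlong φ l γ) {U : ℝ → ℝ} {L : ℝ}
    (hU : ∀ s ∈ Ioo (0 : ℝ) 1, dist x (γ s) ^ 2 ≤ U s)
    (hL : Tendsto (fun s : ℝ => (U s - dist x z ^ 2) / s) (𝓝[>] 0) (𝓝 L)) :
    2 * τ * ((φ z).toReal - (φ y).toReal) + l * τ * dist z y ^ 2 ≤ L := by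
  have hlim : Tendsto (fun s : ℝ => 2 * τ * ((φ z).toReal - (φ y).toReal)
      + l * τ * (1 - s) * dist z y ^ 2) (𝓝[>] 0)
      (𝓝 (2 * τ * ((φ z).toReal - (φ y).toReal) + l * τ * (1 - 0) * dist z y ^ 2)) := by
    refine Tendsto.mono_left (Continuous.tendsto ?_ 0) nhdsWithin_le_nhds
    fun_prop
  have hle := le_of_tendsto_of_tendsto hlim hL ?_
  · simpa using hle
  filter_upwards [Ioo_mem_nhdsGT (zero_lt_one' ℝ)] with s hs
  have h1 := resolvent_le hbot hx hz (hφ s (Ioo_subset_Icc_self hs))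
  rw [hγ.1, hγ.2.1] at h1
  have h2 : dist x z ^ 2 / (2 * τ) * (2 * τ) = dist x z ^ 2 := by field_simp
  have h3 : dist x (γ s) ^ 2 / (2 * τ) * (2 * τ) = dist x (γ s) ^ 2 := by field_simp
  have h4 := mul_le_mul_of_nonneg_right h1 (show 0 ≤ 2 * τ by positivity)
  rw [le_div_iff₀ hs.1]
  have h5 := hU s hs
  linarith

/-- Optimality of `z` along the geodesic `γ` from `z` to `y` bounds the slope `L` of `d²(x, γ(s))`
from below. By commutativity `L` is also the slope of `d²(y, η(t))` along `η` from `z` to `x`, and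
`K`-convexity along `η` bounds it from above by `d²(x,y) - d²(z,y) - (K/2) d²(x,z)`. -/
theorem resolventIneq_of_commuting (hbot : ∀ x, φ x ≠ ⊥) {l K : ℝ}
    (h : HasCommutingGeodesics φ l K) : ResolventIneq φ (-l) (-min 0 K) := by
  obtain ⟨Γ, hgeo, hjoin, hcomm, hK, hconv⟩ := h
  intro τ x z y hτ hx hy hz
  have hzt := resolvent_ne_top hx hz
  obtain ⟨γ, hγ, hγ0, hγ1⟩ := hjoin z y hzt hy
  obtain ⟨η, hη, hη0, hη1⟩ := hjoin z x hzt hx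
  obtain ⟨L, hL1, hL2⟩ := hcomm γ hγ η hη (hγ0.trans hη0.symm)
  rw [hη1, hγ0] at hL1
  rw [hη0, hγ1] at hL2
  have hg := hgeo γ hγ
  rw [hγ0, hγ1] at hg
  have h1 := le_slope_of_mem_resolvent hbot hτ hx hz hg
    (hconv γ hγ (by rwa [hγ0]) (by rwa [hγ1])) (U := fun s => dist (γ s) x ^ 2) (L := L)
    (fun s _ => by rw [dist_comm]) (by rwa [dist_comm x z])
  have hlim : Tendsto (fun t : ℝ => dist y x ^ 2 - dist y z ^ 2 - K / 2 * (1 - t) * dist z x ^ 2)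
      (𝓝[>] 0) (𝓝 (dist y x ^ 2 - dist y z ^ 2 - K / 2 * (1 - 0) * dist z x ^ 2)) := by
    refine Tendsto.mono_left (Continuous.tendsto ?_ 0) nhdsWithin_le_nhds
    fun_prop
  have h2 := le_of_tendsto_of_tendsto hL2 hlim (by
    filter_upwards [Ioo_mem_nhdsGT (zero_lt_one' ℝ)] with t ht
    have := hK η hη y t (Ioo_subset_Icc_self ht)
    rw [hη0, hη1] at this
    rw [div_le_iff₀ ht.1, dist_comm (η t) y, dist_comm z y]
    linarith)
  rw [dist_comm y x, dist_comm y z, dist_comm z x] at h2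
  have h3 := mul_le_mul_of_nonneg_right (min_le_right 0 K) (sq_nonneg (dist x z))
  linarith

theorem ResolventIneq.mono {μ κ κ' : ℝ} (h : ResolventIneq φ μ κ) (hκ : κ ≤ κ') :
    ResolventIneq φ μ κ' := fun τ x z y hτ hx hy hz =>
  (h τ x z y hτ hx hy hz).trans (by
    have := mul_le_mul_of_nonneg_right hκ (sq_nonneg (dist x z))
    linarith)

end OneStep

/-! ### Spherical trigonometry -/

theorem mul_sin_le_mul_sin {a c : ℝ} (ha : 0 ≤ a) (hac : a ≤ c) (hc : c ≤ Real.pi) :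
    a * Real.sin c ≤ c * Real.sin a := by
  rcases ha.eq_or_lt with rfl | ha
  · simp
  have hc0 : 0 < c := ha.trans_le hac
  have h := strictConcaveOn_sin_Icc.concaveOn.2 (left_mem_Icc.2 Real.pi_pos.le)
    (show c ∈ Icc 0 Real.pi from ⟨hc0.le, hc⟩)
    (show 0 ≤ 1 - a / c from sub_nonneg.2 ((div_le_one hc0).2 hac))
    (show 0 ≤ a / c by positivity) (by ring)
  simp only [smul_eq_mul, mul_zero, Real.sin_zero, zero_add, div_mul_cancel₀ _ hc0.ne'] at h
  rw [div_mul_eq_mul_div, div_le_iff₀ hc0] at h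
  linarith

/-- Since `sin u / u` decreases on `(0, π]`, the function `u² + 2 (c / sin c) cos u` attains its
minimum over `[0, π]` at `u = c`. -/
theorem mul_cos_sub_cos_le {a c : ℝ} (ha : 0 ≤ a) (haπ : a ≤ Real.pi) (hc : 0 < c)
    (hcπ : c < Real.pi) :
    2 * (c / Real.sin c) * (Real.cos c - Real.cos a) ≤ a ^ 2 - c ^ 2 := by
  have hs := Real.sin_pos_of_pos_of_lt_pi hc hcπ
  set h : ℝ → ℝ := fun u => u ^ 2 + 2 * (c / Real.sin c) * Real.cos u with hh
  have hd : ∀ u, HasDerivAt h (2 * (u - c / Real.sin c * Real.sin u)) u := fun u =>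
    (((hasDerivAt_id u).pow 2).add ((Real.hasDerivAt_cos u).const_mul _)).congr_deriv (by
      simp
      ring)
  have key : h c ≤ h a := by
    rcases le_total a c with hac | hac
    · refine antitoneOn_of_hasDerivWithinAt_nonpos (convex_Icc a c)
        (fun u _ => (hd u).continuousAt.continuousWithinAt)
        (fun u _ => (hd u).hasDerivWithinAt) (fun u hu => ?_)
        (left_mem_Icc.2 hac) (right_mem_Icc.2 hac) hac
      rw [interior_Icc] at hu
      have h1 := mul_sin_le_mul_sin (ha.trans hu.1.le) hu.2.le hcπ.le
      have h2 : u ≤ c / Real.sin c * Real.sin u := by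
        rwa [div_mul_eq_mul_div, le_div_iff₀ hs]
      linarith
    · refine monotoneOn_of_hasDerivWithinAt_nonneg (convex_Icc c a)
        (fun u _ => (hd u).continuousAt.continuousWithinAt)
        (fun u _ => (hd u).hasDerivWithinAt) (fun u hu => ?_)
        (left_mem_Icc.2 hac) (right_mem_Icc.2 hac) hac
      rw [interior_Icc] at hu
      have h1 := mul_sin_le_mul_sin hc.le hu.1.le (hu.2.le.trans haπ)
      have h2 : c / Real.sin c * Real.sin u ≤ u := by
        rwa [div_mul_eq_mul_div, div_le_iff₀ hs]
      linarith
  simp only [hh] at key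
  linarith

/-- The cosine of the angle at a vertex of a spherical triangle, `a` being the length of the
opposite side. -/
def sphericalCos (a b c : ℝ) : ℝ :=
  (Real.cos a - Real.cos b * Real.cos c) / (Real.sin b * Real.sin c)

/-- In the plane the right side minus the left side is `b²`; here that slack absorbs the curvature.
After `mul_cos_sub_cos_le` it remains to see that `cos a (b - sin b) + cos c (sin b - b cos b) ≥ 0`,
where the bound `π/2` on the sides makes both cosines nonnegative. -/
theorem sphericalCos_estimate {a b c : ℝ} (ha : 0 ≤ a) (ha' : a ≤ Real.pi / 2) (hb : 0 < b)
    (hb' : b < Real.pi / 2) (hc : 0 < c) (hc' : c < Real.pi / 2) :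
    -(2 * b * c * sphericalCos a b c) ≤ a ^ 2 - c ^ 2 := by
  have hsb := Real.sin_pos_of_pos_of_lt_pi hb (by linarith [Real.pi_pos])
  have hsc := Real.sin_pos_of_pos_of_lt_pi hc (by linarith [Real.pi_pos])
  have hca : 0 ≤ Real.cos a := Real.cos_nonneg_of_neg_pi_div_two_le_of_le (by linarith) ha'
  have hcc : 0 ≤ Real.cos c := Real.cos_nonneg_of_neg_pi_div_two_le_of_le (by linarith) hc'.le
  have hcb : 0 < Real.cos b := Real.cos_pos_of_mem_Ioo ⟨by linarith, hb'⟩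
  have h1 := mul_cos_sub_cos_le ha (by linarith [Real.pi_pos]) hc (by linarith [Real.pi_pos])
  have h2 : Real.sin b ≤ b := Real.sin_le hb.le
  have h3 : b * Real.cos b ≤ Real.sin b := by
    have := Real.lt_tan hb hb'
    rw [Real.tan_eq_sin_div_cos, lt_div_iff₀ hcb] at this
    exact this.le
  have h4 : Real.cos a - Real.cos c ≤
      b / Real.sin b * (Real.cos a - Real.cos b * Real.cos c) := by
    rw [div_mul_eq_mul_div, le_div_iff₀ hsb]
    nlinarith [mul_nonneg hca (sub_nonneg.2 h2), mul_nonneg hcc (sub_nonneg.2 h3)]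
  have h5 := mul_le_mul_of_nonneg_left h4 (show 0 ≤ 2 * (c / Real.sin c) by positivity)
  have h6 : 2 * b * c * sphericalCos a b c = 2 * (c / Real.sin c) *
      (b / Real.sin b * (Real.cos a - Real.cos b * Real.cos c)) := by
    rw [sphericalCos]
    field_simp
  rw [h6]
  linarith

/-- The triangle inequalities amount to `cos (b + c) ≤ cos a ≤ cos (b - c)`. The resulting bound
allows the comparison triangle to be built from `spherePoint`. -/
theorem abs_sphericalCos_le_one {a b c : ℝ} (ha : 0 ≤ a) (hb : 0 < b)
    (hb' : b < Real.pi / 2) (hc : 0 < c) (hc' : c < Real.pi / 2) (h1 : a ≤ b + c)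
    (h2 : b ≤ a + c) (h3 : c ≤ a + b) (haπ : a ≤ Real.pi) :
    -1 ≤ sphericalCos a b c ∧ sphericalCos a b c ≤ 1 := by
  have hsb := Real.sin_pos_of_pos_of_lt_pi hb (by linarith [Real.pi_pos])
  have hsc := Real.sin_pos_of_pos_of_lt_pi hc (by linarith [Real.pi_pos])
  have hm : Real.cos a ≤ Real.cos (b - c) := by
    rw [← Real.cos_abs (b - c)]
    exact Real.cos_le_cos_of_nonneg_of_le_pi (abs_nonneg _) haπ
      (abs_le.2 ⟨by linarith, by linarith⟩)
  have hp : Real.cos (b + c) ≤ Real.cos a :=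
    Real.cos_le_cos_of_nonneg_of_le_pi ha (by linarith) h1
  rw [Real.cos_sub] at hm
  rw [Real.cos_add] at hp
  constructor
  · rw [sphericalCos, le_div_iff₀ (mul_pos hsb hsc)]
    linarith
  · rw [sphericalCos, div_le_one (mul_pos hsb hsc)]
    linarith

/-- The point of `𝕊²` at distance `r` from the first basis vector, `C` being the cosine of the
angle with the equator. -/
def spherePoint (r C : ℝ) (hC : -1 ≤ C ∧ C ≤ 1) : Sphere2 :=
  ⟨!₂[Real.cos r, Real.sin r * C, Real.sin r * Real.sqrt (1 - C ^ 2)], by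
    have h : Real.sqrt (1 - C ^ 2) ^ 2 = 1 - C ^ 2 := Real.sq_sqrt (by nlinarith [hC.1, hC.2])
    rw [mem_sphere_zero_iff_norm, EuclideanSpace.norm_eq, Real.sqrt_eq_one]
    simp only [Real.norm_eq_abs, sq_abs, Fin.sum_univ_three, Matrix.cons_val]
    rw [mul_pow, mul_pow, h]
    linear_combination Real.sin_sq_add_cos_sq r⟩

theorem sphereDist_spherePoint {r r' C C' : ℝ} (hC : -1 ≤ C ∧ C ≤ 1) (hC' : -1 ≤ C' ∧ C' ≤ 1) :
    sphereDist (spherePoint r C hC) (spherePoint r' C' hC') =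
      Real.arccos (Real.cos r * Real.cos r' + Real.sin r * Real.sin r' *
        (C * C' + Real.sqrt (1 - C ^ 2) * Real.sqrt (1 - C' ^ 2))) := by
  have h1 := norm_eq_of_mem_sphere (spherePoint r C hC)
  have h2 := norm_eq_of_mem_sphere (spherePoint r' C' hC')
  rw [sphereDist, InnerProductGeometry.angle, h1, h2]
  congr 1
  simp only [spherePoint, PiLp.inner_apply, Fin.sum_univ_three, Matrix.cons_val,
    RCLike.inner_apply, conj_trivial]
  ring

theorem sphereDist_comm (p q : Sphere2) : sphereDist p q = sphereDist q p :=
  InnerProductGeometry.angle_comm _ _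

theorem sphereDist_spherePoint_equator {r r' : ℝ} (h0 : 0 ≤ r' - r) (h1 : r' - r ≤ Real.pi) :
    sphereDist (spherePoint r 1 (by norm_num)) (spherePoint r' 1 (by norm_num)) = r' - r := by
  rw [sphereDist_spherePoint]
  have : Real.cos r * Real.cos r' + Real.sin r * Real.sin r' *
        (1 * 1 + Real.sqrt (1 - 1 ^ 2) * Real.sqrt (1 - 1 ^ 2)) = Real.cos (r' - r) := by
    rw [Real.cos_sub]
    simp
    ring
  rw [this, Real.arccos_cos h0 h1]

theorem sphereDist_spherePoint_equator_right {r r' C : ℝ} (hC : -1 ≤ C ∧ C ≤ 1) :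
    sphereDist (spherePoint r C hC) (spherePoint r' 1 (by norm_num)) =
      Real.arccos (Real.cos r * Real.cos r' + Real.sin r * Real.sin r' * C) := by
  rw [sphereDist_spherePoint]
  simp

section CAT

variable {X : Type*} [MetricSpace X] {φ : X → EReal}

/-- The `CAT(1)` inequality in coordinates. -/
theorem IsCAT1.dist_le_arccos (h : IsCAT1 X) (hd : ∀ x y : X, dist x y < Real.pi / 2) {x z y : X}
    (hxz : 0 < dist x z) (hzy : 0 < dist z y) {γ : ℝ → X} (hγ : IsMinGeodesic γ z y) {t : ℝ}
    (ht : t ∈ Icc (0 : ℝ) 1) :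
    dist x (γ t) ≤ Real.arccos (Real.cos (dist x z) * Real.cos (t * dist z y)
      + Real.sin (dist x z) * Real.sin (t * dist z y) *
        sphericalCos (dist x y) (dist x z) (dist z y)) := by
  have hC := abs_sphericalCos_le_one (a := dist x y) dist_nonneg hxz (hd x z) hzy (hd z y)
    (dist_triangle _ _ _) (by rw [dist_comm z y]; exact dist_triangle _ _ _)
    (by rw [add_comm]; exact dist_triangle_left _ _ _) (by linarith [hd x y, Real.pi_pos])
  have hπ := Real.pi_pos
  have h1 := hd x z
  have h2 := hd z y
  have h3 := hd x y
  have hsb := Real.sin_pos_of_pos_of_lt_pi hxz (by linarith)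
  have hsc := Real.sin_pos_of_pos_of_lt_pi hzy (by linarith)
  have ht1 : t * dist z y ≤ dist z y := mul_le_of_le_one_left hzy.le ht.2
  have ht0 : 0 ≤ t * dist z y := mul_nonneg ht.1 hzy.le
  rw [← sphereDist_spherePoint_equator_right hC]
  -- The vertex for `z` is the first basis vector, `y` and the points of `γ` are placed on one great
  -- circle through it, and `x` is placed at the angle with cosine `sphericalCos`. The perimeter is
  -- below `3π/2`.
  refine h.2 x z y (by rw [dist_comm y x]; linarith) γ hγ
    (spherePoint (dist x z) _ hC) (spherePoint 0 1 (by norm_num))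
    (spherePoint (dist z y) 1 (by norm_num)) ?_ ?_ ?_ t ht
    (spherePoint (t * dist z y) 1 (by norm_num)) ?_ ?_
  · rw [sphereDist_spherePoint_equator_right]
    simp only [Real.cos_zero, Real.sin_zero, mul_zero, zero_mul, mul_one, add_zero]
    exact Real.arccos_cos hxz.le (by linarith)
  · rw [sphereDist_spherePoint_equator (by linarith) (by linarith), sub_zero]
  · rw [sphereDist_comm, sphereDist_spherePoint_equator_right, dist_comm y x]
    have : Real.cos (dist x z) * Real.cos (dist z y) + Real.sin (dist x z) * Real.sin (dist z y) *
        sphericalCos (dist x y) (dist x z) (dist z y) = Real.cos (dist x y) := by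
      rw [sphericalCos, mul_div_cancel₀ _ (mul_pos hsb hsc).ne']
      ring
    rw [this, Real.arccos_cos dist_nonneg (by linarith)]
  · rw [sphereDist_spherePoint_equator (by linarith) (by linarith), sub_zero]
  · rw [sphereDist_spherePoint_equator (by linarith) (by linarith)]
    ring

theorem resolventIneq_of_isCAT1 (hbot : ∀ x, φ x ≠ ⊥) {l : ℝ} (hconv : IsSemiConvex φ l)
    (h : IsCAT1 X) (hd : ∀ x y : X, dist x y < Real.pi / 2) : ResolventIneq φ (-l) 0 := by
  intro τ x z y hτ hx hy hz
  have hzt := resolvent_ne_top hx hz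
  obtain ⟨γ, hγ, hφ⟩ := hconv z y hzt hy
  rcases (dist_nonneg (x := z) (y := y)).eq_or_lt with hzy | hzy
  · have : z = y := dist_eq_zero.1 hzy.symm
    subst this
    simp
  -- For `x = z` the angle is undefined and `arccos` is not differentiable at `cos 0`, but then
  -- `d(x, γ(s)) = s d(x,y)` and the slope is `0`.
  rcases (dist_nonneg (x := x) (y := z)).eq_or_lt with hxz | hxz
  · have : x = z := dist_eq_zero.1 hxz.symm
    subst this
    have h1 := le_slope_of_mem_resolvent hbot hτ hx hz hγ hφ
      (U := fun s => (s * dist x y) ^ 2) (L := 0) (fun s hs => by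
        have := hγ.2.2 0 (left_mem_Icc.2 zero_le_one) s (Ioo_subset_Icc_self hs)
        rw [hγ.1, zero_sub, abs_neg, abs_of_pos hs.1] at this
        rw [this]) (by
        have : Tendsto (fun s : ℝ => s * dist x y ^ 2) (𝓝[>] 0) (𝓝 (0 * dist x y ^ 2)) :=
          Tendsto.mono_left (Continuous.tendsto (by fun_prop) 0) nhdsWithin_le_nhds
        rw [zero_mul] at this
        refine this.congr' ?_
        filter_upwards [self_mem_nhdsWithin] with s hs
        have : s ≠ 0 := (mem_Ioi.1 hs).ne'
        rw [dist_self]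
        field_simp
        ring)
    simp only [dist_self]
    linarith
  set b := dist x z with hb
  set c := dist z y with hc
  set C := sphericalCos (dist x y) b c with hC
  have hπ := Real.pi_pos
  have hbπ : b < Real.pi / 2 := hd x z
  have hsb := Real.sin_pos_of_pos_of_lt_pi hxz (by linarith)
  have hcb : Real.cos b < 1 := by
    rw [← Real.cos_zero]
    exact Real.cos_lt_cos_of_nonneg_of_le_pi le_rfl (by linarith) hxz
  have hcb0 : 0 < Real.cos b := Real.cos_pos_of_mem_Ioo ⟨by linarith, hbπ⟩
  set g : ℝ → ℝ := fun s => Real.cos b * Real.cos (s * c) + Real.sin b * Real.sin (s * c) * C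
    with hg
  have hg0 : g 0 = Real.cos b := by simp [hg]
  have hgd : HasDerivAt g (Real.sin b * c * C) 0 := by
    have hl : HasDerivAt (fun s : ℝ => s * c) c 0 := by
      simpa using (hasDerivAt_id (0 : ℝ)).mul_const c
    have h1 := (hl.cos.const_mul (Real.cos b)).add ((hl.sin.const_mul (Real.sin b)).mul_const C)
    refine h1.congr_deriv ?_
    simp
  have hUd : HasDerivAt (fun s => Real.arccos (g s) ^ 2) (-(2 * b * c * C)) 0 := by
    have h1 : HasDerivAt Real.arccos (-(1 / Real.sqrt (1 - g 0 ^ 2))) (g 0) :=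
      Real.hasDerivAt_arccos (by rw [hg0]; linarith) (by rw [hg0]; exact hcb.ne)
    have h2 := (h1.comp 0 hgd).pow 2
    refine h2.congr_deriv ?_
    have hs : Real.sqrt (1 - Real.cos b ^ 2) = Real.sin b := by
      rw [← Real.sin_sq, Real.sqrt_sq hsb.le]
    simp only [Function.comp, hg0, hs, Real.arccos_cos hxz.le (by linarith : b ≤ Real.pi)]
    field_simp
    norm_num
    ring
  have hlim : Tendsto (fun s => (Real.arccos (g s) ^ 2 - b ^ 2) / s) (𝓝[>] 0)
      (𝓝 (-(2 * b * c * C))) := by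
    have h1 := (hasDerivAt_iff_tendsto_slope.1 hUd).mono_left
      (nhdsWithin_mono 0 (fun s (hs : s ∈ Ioi (0 : ℝ)) => (mem_Ioi.1 hs).ne'))
    refine h1.congr fun s => ?_
    rw [slope_def_field, hg0, Real.arccos_cos hxz.le (by linarith), sub_zero]
  -- Only the spherical majorant of `d²(x, γ(s))` needs a derivative at `0`; the two agree at `s =
  -- 0`.
  have h1 := le_slope_of_mem_resolvent hbot hτ hx hz hγ hφ
    (U := fun s => Real.arccos (g s) ^ 2) (fun s hs =>
      pow_le_pow_left₀ dist_nonneg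
        (h.dist_le_arccos hd hxz hzy hγ (Ioo_subset_Icc_self hs)) 2) hlim
  have h2 := sphericalCos_estimate (a := dist x y) dist_nonneg (hd x y).le hxz hbπ hzy (hd z y)
  linarith

end CAT

/-! ### A priori bound of the energy -/

section Energy

variable {X : Type*} [MetricSpace X] {φ : X → EReal}

theorem le_of_moreauYosida_ne_bot (hbot : ∀ x, φ x ≠ ⊥) {τ : ℝ} {x₀ : X} (hx₀ : φ x₀ ≠ ⊤)
    (h : moreauYosida φ τ x₀ ≠ ⊥) :
    ∃ C : ℝ, 0 ≤ C ∧ ∀ z, φ z ≠ ⊤ →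
      (φ x₀).toReal - (φ z).toReal ≤ C + dist x₀ z ^ 2 / (2 * τ) := by
  have h0 : moreauYosida φ τ x₀ ≤ ((φ x₀).toReal : EReal) := by
    refine (iInf_le _ x₀).trans ?_
    rw [dist_self, EReal.coe_toReal hx₀ (hbot x₀)]
    simp
  have ht : moreauYosida φ τ x₀ ≠ ⊤ := ne_top_of_le_ne_top (EReal.coe_ne_top _) h0
  refine ⟨(φ x₀).toReal - (moreauYosida φ τ x₀).toReal, ?_, fun z hz => ?_⟩
  · rw [← EReal.coe_toReal ht h] at h0
    exact sub_nonneg.2 (EReal.coe_le_coe_iff.1 h0)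
  · have h1 : moreauYosida φ τ x₀ ≤ φ z + ((dist x₀ z ^ 2 / (2 * τ) : ℝ) : EReal) := iInf_le _ z
    rw [← EReal.coe_toReal ht h, ← EReal.coe_toReal hz (hbot z)] at h1
    have h2 : (moreauYosida φ τ x₀).toReal ≤ (φ z).toReal + dist x₀ z ^ 2 / (2 * τ) := by
      exact_mod_cast h1
    linarith

/-- The sum contains `f n` itself, so the last term has to be absorbed on the left; for `u ≤ 1/2`
one has `1 / (1 - u) ≤ 1 + 2u ≤ exp (2u)`. The induction runs on the right side of the hypothesis
rather than on `f`. -/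
theorem discrete_gronwall {P : TimePartition} {f : ℕ → ℝ} {A B : ℝ} (hA : 0 ≤ A) (hB : 0 ≤ B)
    (hf : ∀ k, 0 ≤ f k) (hstep : ∀ k, B * (P.pt (k + 1) - P.pt k) ≤ 1 / 2)
    (h : ∀ n, f n ≤ A + B * ∑ i ∈ Finset.range n, (P.pt (i + 1) - P.pt i) * f (i + 1)) (n : ℕ) :
    f n ≤ A * Real.exp (2 * B * P.pt n) := by
  refine (h n).trans ?_
  induction n with
  | zero => simp [P.pt_zero]
  | succ n ih =>
    have h1 := h (n + 1)
    rw [Finset.sum_range_succ] at h1 ⊢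
    set S := A + B * ∑ i ∈ Finset.range n, (P.pt (i + 1) - P.pt i) * f (i + 1) with hS
    set u := B * (P.pt (n + 1) - P.pt n) with hu
    have hu0 : 0 ≤ u := mul_nonneg hB (P.step_pos n).le
    have hu1 : u ≤ 1 / 2 := hstep n
    have hS0 : 0 ≤ S := by
      refine add_nonneg hA (mul_nonneg hB (Finset.sum_nonneg fun i _ => ?_))
      exact mul_nonneg (P.step_pos i).le (hf _)
    have e1 : A + B * (∑ i ∈ Finset.range n, (P.pt (i + 1) - P.pt i) * f (i + 1)
        + (P.pt (n + 1) - P.pt n) * f (n + 1)) = S + u * f (n + 1) := by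
      rw [hS, hu]
      ring
    rw [e1] at h1 ⊢
    have h2 : f (n + 1) ≤ S * (1 + 2 * u) := by
      have h3 : f (n + 1) * (1 - u) ≤ S := by linarith
      have h4 := mul_le_mul_of_nonneg_right h3 (show 0 ≤ 1 + 2 * u by positivity)
      nlinarith [mul_nonneg (hf (n + 1)) (mul_nonneg hu0 (show 0 ≤ 1 - 2 * u by linarith))]
    have h3 : S + u * f (n + 1) ≤ S * (1 + 2 * u) := by
      nlinarith [mul_nonneg hS0 (mul_nonneg hu0 (show 0 ≤ 1 - 2 * u by linarith)),
        mul_le_mul_of_nonneg_left h2 hu0]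
    calc S + u * f (n + 1) ≤ S * (1 + 2 * u) := h3
      _ ≤ S * Real.exp (2 * u) := by
        refine mul_le_mul_of_nonneg_left ?_ hS0
        rw [add_comm]
        exact Real.add_one_le_exp _
      _ ≤ A * Real.exp (2 * B * P.pt n) * Real.exp (2 * u) :=
        mul_le_mul_of_nonneg_right ih (Real.exp_pos _).le
      _ = A * Real.exp (2 * B * P.pt (n + 1)) := by
        rw [mul_assoc, ← Real.exp_add, hu]
        ring_nf

/-- Young's inequality applied to `b² - a² ≤ 2Db`, weighted so that the `D²` part becomes a multiple
of the energy drop, independent of the step `η`, and telescopes. -/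
theorem sq_sub_sq_le {a b D ε η Δ : ℝ} (ha : 0 ≤ a) (hb : 0 ≤ b) (hD : 0 ≤ D) (hab : b ≤ a + D)
    (hε : 0 < ε) (hη : 0 < η) (hDΔ : D ^ 2 ≤ 2 * η * Δ) :
    b ^ 2 - a ^ 2 ≤ 2 * ε * Δ + η / ε * b ^ 2 := by
  have h1 : b ^ 2 - a ^ 2 ≤ 2 * D * b := by
    rcases le_total a b with h | h <;> nlinarith
  have h2 : ε / η * D ^ 2 ≤ 2 * ε * Δ := by
    have := mul_le_mul_of_nonneg_left hDΔ (show 0 ≤ ε / η by positivity)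
    have e : ε / η * (2 * η * Δ) = 2 * ε * Δ := by field_simp
    linarith
  have h3 : 0 ≤ η / ε * (ε / η * D - b) ^ 2 := by positivity
  have e : η / ε * (ε / η * D - b) ^ 2 = ε / η * D ^ 2 - 2 * D * b + η / ε * b ^ 2 := by
    field_simp
    ring
  linarith

/-- The decrease of the energy along discrete solutions is bounded on bounded time intervals. -/
theorem exists_energy_bound (hbot : ∀ x, φ x ≠ ⊥) {τ : ℝ} (hτ : 0 < τ) {x₀ : X} (hx₀ : φ x₀ ≠ ⊤)
    (h : moreauYosida φ τ x₀ ≠ ⊥) (T : ℝ) :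
    ∃ H δ : ℝ, 0 ≤ H ∧ 0 < δ ∧ ∀ (P : TimePartition) (x : ℕ → X), IsDiscreteSolution φ P x₀ x →
      (∀ k, P.pt (k + 1) - P.pt k ≤ δ) → ∀ k, P.pt k ≤ T →
        (φ x₀).toReal - (φ (x (k + 1))).toReal ≤ H := by
  obtain ⟨C, hC, hCle⟩ := le_of_moreauYosida_ne_bot hbot hx₀ h
  -- With `ε = τ/2` the telescoped energy contributes `τ(C + d²/(2τ)) = τC + d²/2`, half of which is
  -- absorbed on the left. This gives Gronwall constants `A = 2τC` and `B = 4/τ`. Steps of at most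
  -- `τ/8` make `B` times a step at most `1/2` and keep `t^{k+1} ≤ T + τ/8`.
  refine ⟨C + 2 * τ * C * Real.exp (2 * (4 / τ) * (T + τ / 8)) / (2 * τ), τ / 8, by positivity,
    by positivity, fun P x hx hP k hk => ?_⟩
  have hf : ∀ n, dist x₀ (x n) ^ 2 ≤ 2 * τ * C * Real.exp (2 * (4 / τ) * P.pt n) := by
    refine discrete_gronwall (by positivity) (by positivity) (fun k => sq_nonneg _)
      (fun k => ?_) (fun n => ?_)
    · have := mul_le_mul_of_nonneg_left (hP k) (show 0 ≤ 4 / τ by positivity)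
      have e : 4 / τ * (τ / 8) = 1 / 2 := by
        field_simp
        norm_num
      linarith
    · have hsum : dist x₀ (x n) ^ 2 - dist x₀ (x 0) ^ 2 ≤ ∑ i ∈ Finset.range n,
          (2 * (τ / 2) * ((φ (x i)).toReal - (φ (x (i + 1))).toReal)
            + (P.pt (i + 1) - P.pt i) / (τ / 2) * dist x₀ (x (i + 1)) ^ 2) := by
        rw [← Finset.sum_range_sub (fun i => dist x₀ (x i) ^ 2)]
        exact Finset.sum_le_sum fun i _ => sq_sub_sq_le dist_nonneg dist_nonneg dist_nonneg
          (dist_triangle _ _ _) (by positivity) (P.step_pos i) (hx.sq_dist_le hbot hx₀ i)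
      rw [Finset.sum_add_distrib, ← Finset.mul_sum,
        Finset.sum_range_sub' (fun i => (φ (x i)).toReal), hx.1, dist_self] at hsum
      have h1 := hCle (x n) (hx.ne_top hx₀ n)
      have h2 := mul_le_mul_of_nonneg_left h1 hτ.le
      have e1 : τ * (C + dist x₀ (x n) ^ 2 / (2 * τ)) = τ * C + dist x₀ (x n) ^ 2 / 2 := by
        field_simp
      have e2 : ∑ i ∈ Finset.range n, (P.pt (i + 1) - P.pt i) / (τ / 2) * dist x₀ (x (i + 1)) ^ 2
          = 2 / τ * ∑ i ∈ Finset.range n, (P.pt (i + 1) - P.pt i) * dist x₀ (x (i + 1)) ^ 2 := by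
        rw [Finset.mul_sum]
        refine Finset.sum_congr rfl fun i _ => ?_
        field_simp
      rw [e2] at hsum
      have e3 : 4 / τ = 2 * (2 / τ) := by ring
      rw [e3]
      linarith
  have h1 := hCle (x (k + 1)) (hx.ne_top hx₀ _)
  refine h1.trans (add_le_add_right ?_ _)
  refine div_le_div_of_nonneg_right ((hf (k + 1)).trans ?_) (by positivity)
  refine mul_le_mul_of_nonneg_left (Real.exp_le_exp.2 ?_) (by positivity)
  exact mul_le_mul_of_nonneg_left (by linarith [hP k]) (by positivity)

end Energy

/-! ### Convergence of discrete solutions -/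

theorem TimePartition.step_le_of_mesh_lt (P : TimePartition) {δ : ℝ}
    (h : P.mesh < ENNReal.ofReal δ) (k : ℕ) : P.pt (k + 1) - P.pt k ≤ δ := by
  have h1 : ENNReal.ofReal (P.pt (k + 1) - P.pt k) ≤ P.mesh :=
    le_iSup (fun k : ℕ => ENNReal.ofReal (P.pt (k + 1) - P.pt k)) k
  by_contra hc
  exact absurd (ENNReal.ofReal_le_ofReal (not_le.1 hc).le) (not_le.2 (h1.trans_lt h))

/-- The partition into intervals of the same length. -/
def uniformPartition (h : ℝ) (hh : 0 < h) : TimePartition where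
  pt k := k * h
  pt_zero := by simp
  strictMono := fun a b hab => mul_lt_mul_of_pos_right (Nat.cast_lt.2 hab) hh
  tendsto_atTop := tendsto_natCast_atTop_atTop.atTop_mul_const hh

theorem uniformPartition_step (h : ℝ) (hh : 0 < h) (k : ℕ) :
    (uniformPartition h hh).pt (k + 1) - (uniformPartition h hh).pt k = h := by
  simp only [uniformPartition]
  push_cast
  ring

theorem uniformPartition_mesh (h : ℝ) (hh : 0 < h) :
    (uniformPartition h hh).mesh = ENNReal.ofReal h := by
  simp only [TimePartition.mesh, uniformPartition_step, ciSup_const]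

/-- This recovers the true distance `d` from the interpolated one: a weighted average of the corner
squares is at least `(d - e)²` when `d ≥ e`, where `e` accounts for the lengths of the last jumps.
-/
theorem le_sqrt_bilerp {d00 d01 d10 d11 d e w m : ℝ} (hw0 : 0 ≤ w) (hw1 : w ≤ 1) (hm0 : 0 ≤ m)
    (hm1 : m ≤ 1) (h00 : d ≤ d00 + e) (h01 : d ≤ d01 + e) (h10 : d ≤ d10 + e)
    (h11 : d ≤ d11 + e) :
    d ≤ Real.sqrt ((d00 ^ 2 + m * (d01 ^ 2 - d00 ^ 2))
      + w * ((d10 ^ 2 + m * (d11 ^ 2 - d10 ^ 2)) - (d00 ^ 2 + m * (d01 ^ 2 - d00 ^ 2)))) + e := by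
  rcases le_total (d - e) 0 with h | h
  · linarith [Real.sqrt_nonneg ((d00 ^ 2 + m * (d01 ^ 2 - d00 ^ 2))
      + w * ((d10 ^ 2 + m * (d11 ^ 2 - d10 ^ 2)) - (d00 ^ 2 + m * (d01 ^ 2 - d00 ^ 2))))]
  · rw [← sub_le_iff_le_add]
    refine Real.le_sqrt_of_sq_le ?_
    have hw2 := sub_nonneg.2 hw1
    have hm2 := sub_nonneg.2 hm1
    have i00 := mul_le_mul_of_nonneg_left (pow_le_pow_left₀ h (sub_le_iff_le_add.2 h00) 2)
      (mul_nonneg hw2 hm2)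
    have i01 := mul_le_mul_of_nonneg_left (pow_le_pow_left₀ h (sub_le_iff_le_add.2 h01) 2)
      (mul_nonneg hw2 hm0)
    have i10 := mul_le_mul_of_nonneg_left (pow_le_pow_left₀ h (sub_le_iff_le_add.2 h10) 2)
      (mul_nonneg hw0 hm2)
    have i11 := mul_le_mul_of_nonneg_left (pow_le_pow_left₀ h (sub_le_iff_le_add.2 h11) 2)
      (mul_nonneg hw0 hm0)
    linarith

theorem lerp_weight_mem (P : TimePartition) {k : ℕ} {t : ℝ}
    (ht : t ∈ Ioc (P.pt k) (P.pt (k + 1))) :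
    (t - P.pt k) / (P.pt (k + 1) - P.pt k) ∈ Icc (0 : ℝ) 1 :=
  ⟨div_nonneg (by linarith [ht.1]) (P.step_pos k).le,
    (div_le_one (P.step_pos k)).2 (by linarith [ht.2])⟩

/-- Optimization over `c > 0` of the bound of `v` by `exp c * (a ^ 2 + b ^ 2 / c) * s`. -/
theorem le_sq_of_forall_exp {v a b s : ℝ} (ha : 0 < a) (hb : 0 ≤ b) (hs : 0 ≤ s)
    (h : ∀ c : ℝ, 0 < c → v ≤ Real.exp c * ((a ^ 2 + b ^ 2 / c) * s)) :
    v ≤ (a + 2 * b) ^ 2 * s := by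
  rcases hb.eq_or_lt with rfl | hb
  · have hlim : Tendsto (fun c : ℝ => Real.exp c * ((a ^ 2 + 0 ^ 2 / c) * s)) (𝓝[>] 0)
        (𝓝 (Real.exp 0 * (a ^ 2 * s))) := by
      simp only [ne_eq, OfNat.ofNat_ne_zero, not_false_eq_true, zero_pow, zero_div, add_zero]
      exact Tendsto.mono_left (Continuous.tendsto (by fun_prop) 0) nhdsWithin_le_nhds
    have := ge_of_tendsto hlim (by filter_upwards [self_mem_nhdsWithin] with c hc using h c hc)
    simpa using this
  · have hab : 0 < a + b := add_pos ha hb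
    -- For small `b` the optimal value is close to `b / a`; this variant also satisfies `c ≤ 1`, as
    -- `exp c ≤ 1 + c + c²` requires, and leaves a difference with positive coefficients only.
    set c := b / (a + b) with hc
    have hc0 : 0 < c := div_pos hb hab
    have hc1 : c ≤ 1 := (div_le_one hab).2 (by linarith)
    have h1 := h c hc0
    have h2 : Real.exp c ≤ 1 + c + c ^ 2 := by
      have := Real.abs_exp_sub_one_sub_id_le (x := c) (by rwa [abs_of_pos hc0])
      linarith [(abs_le.1 this).2]
    have h3 : b ^ 2 / c = b * (a + b) := by
      rw [hc]
      field_simp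
    rw [h3] at h1
    have h4 : (1 + c + c ^ 2) * (a ^ 2 + b * (a + b)) ≤ (a + 2 * b) ^ 2 := by
      have e : (1 + c + c ^ 2) * (a ^ 2 + b * (a + b)) =
          ((a + b) ^ 2 + b * (a + b) + b ^ 2) * (a ^ 2 + b * (a + b)) / (a + b) ^ 2 := by
        rw [hc]
        field_simp
      rw [e, div_le_iff₀ (by positivity), ← sub_nonneg]
      have e2 : (a + 2 * b) ^ 2 * (a + b) ^ 2
          - ((a + b) ^ 2 + b * (a + b) + b ^ 2) * (a ^ 2 + b * (a + b)) =
          2 * a ^ 3 * b + 6 * a ^ 2 * b ^ 2 + 6 * a * b ^ 3 + b ^ 4 := by ring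
      rw [e2]
      positivity
    calc v ≤ Real.exp c * ((a ^ 2 + b * (a + b)) * s) := h1
      _ ≤ (1 + c + c ^ 2) * ((a ^ 2 + b * (a + b)) * s) :=
        mul_le_mul_of_nonneg_right h2 (by positivity)
      _ = (1 + c + c ^ 2) * (a ^ 2 + b * (a + b)) * s := by ring
      _ ≤ (a + 2 * b) ^ 2 * s := mul_le_mul_of_nonneg_right h4 hs

section Convergence

variable {X : Type*} [MetricSpace X] {φ : X → EReal}

theorem interpDist_sq (P : TimePartition) (x : ℕ → X) {t : ℝ} (ht : 0 < t) (y : X) :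
    interpDist P x t y ^ 2 = P.lerp (fun k => dist (x k) y ^ 2) t := by
  obtain ⟨k, hk⟩ := P.exists_mem_Ioc ht
  rw [interpDist_of_mem_Ioc P x hk, P.lerp_eq _ (Ioc_subset_Icc_self hk), Real.sq_sqrt]
  obtain ⟨h0, h1⟩ := lerp_weight_mem P hk
  have := add_nonneg (mul_nonneg (sub_nonneg.2 h1) (sq_nonneg (dist (x k) y)))
    (mul_nonneg h0 (sq_nonneg (dist (x (k + 1)) y)))
  linarith

theorem exists_discreteSolution {h : ℝ} (hh : 0 < h) (hres : ∀ x, (resolvent φ h x).Nonempty)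
    (x₀ : X) : ∃ x, IsDiscreteSolution φ (uniformPartition h hh) x₀ x := by
  choose J hJ using hres
  refine ⟨fun k => J^[k] x₀, rfl, fun k => ?_⟩
  simp only [uniformPartition_step, Function.iterate_succ_apply']
  exact hJ _

variable {μ κ τ : ℝ} {x₀ : X}

theorem exists_interp_energy_bound (hbot : ∀ x, φ x ≠ ⊥) (hx₀ : φ x₀ ≠ ⊤) (hτ : 0 < τ)
    (hτb : moreauYosida φ τ x₀ ≠ ⊥) (T : ℝ) :
    ∃ H δ : ℝ, 0 ≤ H ∧ 0 < δ ∧ ∀ (P : TimePartition) (x : ℕ → X), IsDiscreteSolution φ P x₀ x →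
      P.mesh < ENNReal.ofReal δ → ∀ t, 0 < t → t ≤ T →
        (φ x₀).toReal - (φ (interp P x t)).toReal ≤ H := by
  obtain ⟨H, δ, hH, hδ, h⟩ := exists_energy_bound hbot hτ hx₀ hτb T
  refine ⟨H, δ, hH, hδ, fun P x hx hP t ht htT => ?_⟩
  obtain ⟨k, hk⟩ := P.exists_mem_Ioc ht
  rw [interp_of_mem_Ioc P x hk]
  exact h P x hx (P.step_le_of_mesh_lt hP) k (hk.1.le.trans htT)

theorem IsDiscreteSolution.sq_dist_le_of_step_le (hbot : ∀ x, φ x ≠ ⊥) (hx₀ : φ x₀ ≠ ⊤)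
    {P : TimePartition} {x : ℕ → X} (hx : IsDiscreteSolution φ P x₀ x) {p H : ℝ}
    (hp : ∀ k, P.pt (k + 1) - P.pt k ≤ p) {k : ℕ}
    (hH : (φ x₀).toReal - (φ (x (k + 1))).toReal ≤ H) :
    dist (x k) (x (k + 1)) ^ 2 ≤ 2 * p * H := by
  have h1 := hx.sq_dist_le hbot hx₀ k
  have h2 := hx.antitone hbot hx₀ (Nat.zero_le k)
  have h3 := hx.antitone hbot hx₀ (Nat.le_succ k)
  simp only [hx.1] at h2
  simp only [Nat.succ_eq_add_one] at h3
  refine h1.trans (mul_le_mul (by linarith [hp k]) (by linarith) (by linarith) ?_)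
  linarith [hp k, P.step_pos k]

/-- Interpolated discrete solutions form a Cauchy family as the mesh tends to `0`. -/
theorem exists_dist_interp_lt (hbot : ∀ x, φ x ≠ ⊥) (hμ : 0 ≤ μ) (hκ : 0 ≤ κ)
    (hres : ResolventIneq φ μ κ) (hx₀ : φ x₀ ≠ ⊤) (hτ : 0 < τ)
    (hτb : moreauYosida φ τ x₀ ≠ ⊥) {t : ℝ} (ht : 0 ≤ t) {ε : ℝ} (hε : 0 < ε) :
    ∃ δ : ℝ, 0 < δ ∧ ∀ (P Q : TimePartition) (x y : ℕ → X), IsDiscreteSolution φ P x₀ x →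
      IsDiscreteSolution φ Q x₀ y → P.mesh < ENNReal.ofReal δ → Q.mesh < ENNReal.ofReal δ →
        dist (interp P x t) (interp Q y t) < ε := by
  rcases ht.eq_or_lt with rfl | ht
  · refine ⟨1, one_pos, fun P Q x y hx hy _ _ => ?_⟩
    rw [interp_zero, interp_zero, hx.1, hy.1, dist_self]
    exact hε
  obtain ⟨H, δ₀, hH, hδ₀, hE⟩ := exists_interp_energy_bound hbot hx₀ hτ hτb t
  -- The bound of `sqDistLerp_le` for meshes at most `m` with `c = c' = 1`, plus the last jump of
  -- each solution; it is continuous and vanishes at `0`.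
  set B : ℝ → ℝ := fun m => Real.sqrt (Real.exp (2 * μ * t) * (Real.exp (1 + 1) *
    (2 * ((1 + κ + (1 + 1 / (2 * 1)) * (2 * m * μ) / 3) * m * H))))
    + (Real.sqrt (2 * m * H) + Real.sqrt (2 * m * H)) with hB
  have hB0 : Tendsto B (𝓝[>] 0) (𝓝 (B 0)) :=
    Tendsto.mono_left (Continuous.tendsto (by fun_prop) 0) nhdsWithin_le_nhds
  have hB00 : B 0 = 0 := by simp [hB]
  rw [hB00] at hB0
  obtain ⟨δ, hδε, hδ0, hδδ⟩ : ∃ δ, B δ < ε ∧ 0 < δ ∧ δ < δ₀ :=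
    ((hB0.eventually_lt_const hε).and (Ioo_mem_nhdsGT hδ₀)).exists
  refine ⟨δ, hδ0, fun P Q x y hx hy hP hQ => lt_of_le_of_lt ?_ hδε⟩
  have hp := P.step_le_of_mesh_lt hP
  have hq := Q.step_le_of_mesh_lt hQ
  have hδδ' := ENNReal.ofReal_le_ofReal hδδ.le
  have hEx := hE P x hx (hP.trans_le hδδ') t ht le_rfl
  have hEy := hE Q y hy (hQ.trans_le hδδ') t ht le_rfl
  have hu := sqDistLerp_le hbot hμ hκ hres hx₀ hx hy hp hq one_pos one_pos ht
  obtain ⟨k, hk⟩ := P.exists_mem_Ioc ht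
  obtain ⟨j, hj⟩ := Q.exists_mem_Ioc ht
  rw [interp_of_mem_Ioc P x hk] at hEx hu ⊢
  rw [interp_of_mem_Ioc Q y hj] at hEy hu ⊢
  have hD := Real.le_sqrt_of_sq_le (hx.sq_dist_le_of_step_le hbot hx₀ hp hEx)
  have hD' := Real.le_sqrt_of_sq_le (hy.sq_dist_le_of_step_le hbot hx₀ hq hEy)
  obtain ⟨hw0, hw1⟩ := lerp_weight_mem P hk
  obtain ⟨hm0, hm1⟩ := lerp_weight_mem Q hj
  have hd := le_sqrt_bilerp (d := dist (x (k + 1)) (y (j + 1)))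
    (e := Real.sqrt (2 * δ * H) + Real.sqrt (2 * δ * H)) hw0 hw1 hm0 hm1
    (d00 := dist (x k) (y j)) (d01 := dist (x k) (y (j + 1))) (d10 := dist (x (k + 1)) (y j))
    (d11 := dist (x (k + 1)) (y (j + 1)))
    (by linarith [dist_triangle4 (x (k + 1)) (x k) (y j) (y (j + 1)),
      dist_comm (x (k + 1)) (x k)])
    (by linarith [dist_triangle (x (k + 1)) (x k) (y (j + 1)), dist_comm (x (k + 1)) (x k),
      Real.sqrt_nonneg (2 * δ * H)])
    (by linarith [dist_triangle (x (k + 1)) (y j) (y (j + 1)), Real.sqrt_nonneg (2 * δ * H)])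
    (by linarith [Real.sqrt_nonneg (2 * δ * H)])
  rw [← sqDistLerp_eq x y (Ioc_subset_Icc_self hk) (Ioc_subset_Icc_self hj)] at hd
  refine hd.trans (add_le_add_left (Real.sqrt_le_sqrt ?_) _)
  have hu2 : Real.exp (-2 * μ * t) * sqDistLerp P Q x y t ≤ Real.exp (1 + 1) *
      (2 * ((1 + κ + (1 + 1 / (2 * 1)) * (2 * δ * μ) / 3) * δ * H)) := by
    refine hu.trans (mul_le_mul_of_nonneg_left ?_ (Real.exp_pos _).le)
    have hA : 0 ≤ (1 + κ + (1 + 1 / (2 * 1)) * (2 * δ * μ) / 3) * δ := by positivity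
    linarith [mul_le_mul_of_nonneg_left hEx hA, mul_le_mul_of_nonneg_left hEy hA]
  have hu3 := mul_le_mul_of_nonneg_left hu2 (Real.exp_pos (2 * μ * t)).le
  rw [← mul_assoc, ← Real.exp_add] at hu3
  simpa using hu3

/-- Convergence in the second variable of the interpolated squared distance. -/
theorem tendsto_lerp_sq_dist (hbot : ∀ x, φ x ≠ ⊥) (hx₀ : φ x₀ ≠ ⊤) (hτ : 0 < τ)
    (hτb : moreauYosida φ τ x₀ ≠ ⊥) {Q : ℕ → TimePartition} {y : ℕ → ℕ → X}
    (hy : ∀ i, IsDiscreteSolution φ (Q i) x₀ (y i))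
    (hQ : Tendsto (fun i => (Q i).mesh) atTop (𝓝 0)) {t : ℝ} (ht : 0 < t) {p : X}
    (hp : Tendsto (fun i => interp (Q i) (y i) t) atTop (𝓝 p)) (z : X) :
    Tendsto (fun i => (Q i).lerp (fun j => dist z (y i j) ^ 2) t) atTop (𝓝 (dist z p ^ 2)) := by
  obtain ⟨H, δ₀, hH, hδ₀, hE⟩ := exists_interp_energy_bound hbot hx₀ hτ hτb t
  choose j hj using fun i => (Q i).exists_mem_Ioc ht
  have hy1 : Tendsto (fun i => y i (j i + 1)) atTop (𝓝 p) :=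
    hp.congr fun i => interp_of_mem_Ioc (Q i) (y i) (hj i)
  have hmesh : Tendsto (fun i => 2 * (Q i).mesh.toReal * H) atTop (𝓝 0) := by
    have := ((ENNReal.tendsto_toReal ENNReal.zero_ne_top).comp hQ).const_mul 2 |>.mul_const H
    simpa using this
  -- Squared jumps are at most `2 |τ| H`, so both ends of the cell containing `t` converge to `p`.
  have hstep : Tendsto (fun i => dist (y i (j i)) (y i (j i + 1)) ^ 2) atTop (𝓝 0) := by
    refine squeeze_zero' (Eventually.of_forall fun i => sq_nonneg _) ?_ hmesh
    filter_upwards [hQ.eventually_lt_const (ENNReal.ofReal_pos.2 hδ₀)] with i hi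
    refine (hy i).sq_dist_le_of_step_le hbot hx₀ ((Q i).step_le_mesh hi.ne_top) ?_
    rw [← interp_of_mem_Ioc (Q i) (y i) (hj i)]
    exact hE (Q i) (y i) (hy i) hi t ht le_rfl
  have hstep' : Tendsto (fun i => dist (y i (j i)) (y i (j i + 1))) atTop (𝓝 0) := by
    have := hstep.sqrt
    simpa [Real.sqrt_sq] using this
  have hy0 : Tendsto (fun i => y i (j i)) atTop (𝓝 p) :=
    hy1.congr_dist (hstep'.congr fun i => dist_comm _ _)
  have hd0 : Tendsto (fun i => dist z (y i (j i)) ^ 2) atTop (𝓝 (dist z p ^ 2)) :=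
    (tendsto_const_nhds.dist hy0).pow 2
  have hd1 : Tendsto (fun i => dist z (y i (j i + 1)) ^ 2) atTop (𝓝 (dist z p ^ 2)) :=
    (tendsto_const_nhds.dist hy1).pow 2
  have hdiff : Tendsto (fun i => (t - (Q i).pt (j i)) / ((Q i).pt (j i + 1) - (Q i).pt (j i)) *
      (dist z (y i (j i + 1)) ^ 2 - dist z (y i (j i)) ^ 2)) atTop (𝓝 0) := by
    have h0 : Tendsto (fun i => |dist z (y i (j i + 1)) ^ 2 - dist z (y i (j i)) ^ 2|) atTop
        (𝓝 0) := by
      have := (hd1.sub hd0).abs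
      simpa using this
    refine squeeze_zero_norm (fun i => ?_) h0
    rw [Real.norm_eq_abs, abs_mul]
    obtain ⟨hw0, hw1⟩ := lerp_weight_mem (Q i) (hj i)
    rw [abs_of_nonneg hw0]
    exact mul_le_of_le_one_left (abs_nonneg _) hw1
  have h := hd0.add hdiff
  rw [add_zero] at h
  exact h.congr fun i => ((Q i).lerp_eq _ (Ioc_subset_Icc_self (hj i))).symm

/-- The error estimate for a limit of interpolated discrete solutions. -/
theorem interpDist_sq_le (hbot : ∀ x, φ x ≠ ⊥) (hμ : 0 ≤ μ) (hκ : 0 ≤ κ)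
    (hres : ResolventIneq φ μ κ) (hx₀ : φ x₀ ≠ ⊤) (hτ : 0 < τ)
    (hτb : moreauYosida φ τ x₀ ≠ ⊥) {ξ : ℝ → X} (hξ : IsGradientCurve φ x₀ ξ)
    {P : TimePartition} {x : ℕ → X} (hx : IsDiscreteSolution φ P x₀ x) {p : ℝ}
    (hp : ∀ k, P.pt (k + 1) - P.pt k ≤ p) {t : ℝ} (ht : 0 < t) :
    interpDist P x t (ξ t) ^ 2 ≤ Real.exp (2 * μ * t) *
      (Real.sqrt (1 + κ + 2 * μ / 3 * p) + Real.sqrt (4 * μ / 3 * p)) ^ 2 * p *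
        ((φ x₀).toReal - (φ (interp P x t)).toReal) := by
  obtain ⟨Q, y, hy, hQ, hlim⟩ := hξ
  have hp0 : 0 ≤ p := (P.step_pos 0).le.trans (hp 0)
  have hlt := hlim t ht.le
  obtain ⟨H, δ₀, hH, hδ₀, hE⟩ := exists_interp_energy_bound hbot hx₀ hτ hτb t
  obtain ⟨k, hk⟩ := P.exists_mem_Ioc ht
  have hΔ : 0 ≤ (φ x₀).toReal - (φ (interp P x t)).toReal := by
    have := hx.antitone hbot hx₀ (Nat.zero_le (k + 1))
    simp only [hx.1] at this
    rw [interp_of_mem_Ioc P x hk]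
    linarith
  set Δ := (φ x₀).toReal - (φ (interp P x t)).toReal with hΔdef
  have hconv : Tendsto (fun i => sqDistLerp P (Q i) x (y i) t) atTop
      (𝓝 (interpDist P x t (ξ t) ^ 2)) := by
    rw [interpDist_sq P x ht, P.lerp_eq _ (Ioc_subset_Icc_self hk)]
    have h0 := tendsto_lerp_sq_dist hbot hx₀ hτ hτb hy hQ ht hlt (x k)
    have h1 := tendsto_lerp_sq_dist hbot hx₀ hτ hτb hy hQ ht hlt (x (k + 1))
    exact (h0.add ((h1.sub h0).const_mul _)).congr fun i =>
      (P.lerp_eq _ (Ioc_subset_Icc_self hk)).symm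
  have hq : Tendsto (fun i => (Q i).mesh.toReal) atTop (𝓝 0) := by
    have := (ENNReal.tendsto_toReal ENNReal.zero_ne_top).comp hQ
    rwa [ENNReal.toReal_zero] at this
  -- With `c` and `c'` fixed, the error of the approximating solutions vanishes with their mesh.
  -- Only afterwards can `c'` tend to `0`, since that error contains `1 / c'`.
  have h1 : ∀ c c' : ℝ, 0 < c → 0 < c' →
      Real.exp (-2 * μ * t) * interpDist P x t (ξ t) ^ 2 ≤ Real.exp (c + c') *
        ((1 + κ + (1 + 1 / (2 * c)) * (2 * p * μ) / 3) * p * Δ) := by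
    intro c c' hc hc'
    have hR : Tendsto (fun i => Real.exp (c + c') *
        ((1 + κ + (1 + 1 / (2 * c)) * (2 * p * μ) / 3) * p * Δ +
          (1 + κ + (1 + 1 / (2 * c')) * (2 * (Q i).mesh.toReal * μ) / 3) * (Q i).mesh.toReal * H))
        atTop (𝓝 (Real.exp (c + c') * ((1 + κ + (1 + 1 / (2 * c)) * (2 * p * μ) / 3) * p * Δ +
          (1 + κ + (1 + 1 / (2 * c')) * (2 * 0 * μ) / 3) * 0 * H))) := by
      have hcont : Continuous fun q : ℝ => Real.exp (c + c') *
        ((1 + κ + (1 + 1 / (2 * c)) * (2 * p * μ) / 3) * p * Δ +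
          (1 + κ + (1 + 1 / (2 * c')) * (2 * q * μ) / 3) * q * H) := by fun_prop
      exact (hcont.tendsto 0).comp hq
    rw [mul_zero _, zero_mul, add_zero] at hR
    refine le_of_tendsto_of_tendsto (hconv.const_mul _) hR ?_
    filter_upwards [hQ.eventually_lt_const (ENNReal.ofReal_pos.2 hδ₀)] with i hi
    refine (sqDistLerp_le hbot hμ hκ hres hx₀ hx (hy i) hp ((Q i).step_le_mesh hi.ne_top)
      hc hc' ht).trans (mul_le_mul_of_nonneg_left (add_le_add_right ?_ _) (Real.exp_pos _).le)
    refine mul_le_mul_of_nonneg_left (hE _ _ (hy i) hi t ht le_rfl) ?_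
    have : 0 ≤ (Q i).mesh.toReal := ENNReal.toReal_nonneg
    positivity
  -- The coefficient splits as `(1 + κ + 2μp/3) + (μp/3)/c`, the form `a² + b²/c` optimized in
  -- `le_sq_of_forall_exp`; the second square root of the final constant is `2b`.
  have h2 : ∀ c : ℝ, 0 < c → Real.exp (-2 * μ * t) * interpDist P x t (ξ t) ^ 2 ≤ Real.exp c *
      ((Real.sqrt (1 + κ + 2 * μ / 3 * p) ^ 2 + Real.sqrt (μ / 3 * p) ^ 2 / c) * (p * Δ)) := by
    intro c hc
    have hcont : Tendsto (fun c' : ℝ => Real.exp (c + c') *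
        ((1 + κ + (1 + 1 / (2 * c)) * (2 * p * μ) / 3) * p * Δ)) (𝓝[>] 0)
        (𝓝 (Real.exp (c + 0) * ((1 + κ + (1 + 1 / (2 * c)) * (2 * p * μ) / 3) * p * Δ))) :=
      Tendsto.mono_left (Continuous.tendsto (by fun_prop) 0) nhdsWithin_le_nhds
    have h := ge_of_tendsto hcont
      (by filter_upwards [self_mem_nhdsWithin] with c' hc' using h1 c c' hc hc')
    rw [add_zero] at h
    refine h.trans_eq ?_
    rw [Real.sq_sqrt (by positivity), Real.sq_sqrt (by positivity)]
    field_simp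
    ring
  have h3 := le_sq_of_forall_exp (Real.sqrt_pos.2 (by positivity)) (Real.sqrt_nonneg _)
    (mul_nonneg hp0 hΔ) h2
  have h4 : 2 * Real.sqrt (μ / 3 * p) = Real.sqrt (4 * μ / 3 * p) := by
    rw [show 4 * μ / 3 * p = 2 ^ 2 * (μ / 3 * p) by ring, Real.sqrt_mul (x := 2 ^ 2) (by norm_num),
      Real.sqrt_sq zero_le_two]
  rw [h4] at h3
  have h5 := mul_le_mul_of_nonneg_left h3 (Real.exp_pos (2 * μ * t)).le
  rw [← mul_assoc, ← Real.exp_add] at h5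
  have h6 : 2 * μ * t + -2 * μ * t = 0 := by ring
  rw [h6, Real.exp_zero, one_mul] at h5
  linarith

theorem isGradientCurve_unique (hbot : ∀ x, φ x ≠ ⊥) (hμ : 0 ≤ μ) (hκ : 0 ≤ κ)
    (hres : ResolventIneq φ μ κ) (hx₀ : φ x₀ ≠ ⊤) (hτ : 0 < τ)
    (hτb : moreauYosida φ τ x₀ ≠ ⊥) {ξ ζ : ℝ → X} (hξ : IsGradientCurve φ x₀ ξ)
    (hζ : IsGradientCurve φ x₀ ζ) {t : ℝ} (ht : 0 ≤ t) : ξ t = ζ t := by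
  obtain ⟨P, x, hx, hP, hxl⟩ := hξ
  obtain ⟨Q, y, hy, hQ, hyl⟩ := hζ
  refine dist_le_zero.1 (le_of_forall_pos_le_add fun ε hε => ?_)
  obtain ⟨δ, hδ, h⟩ := exists_dist_interp_lt hbot hμ hκ hres hx₀ hτ hτb ht hε
  rw [zero_add]
  refine le_of_tendsto ((hxl t ht).dist (hyl t ht)) ?_
  filter_upwards [hP.eventually_lt_const (ENNReal.ofReal_pos.2 hδ),
    hQ.eventually_lt_const (ENNReal.ofReal_pos.2 hδ)] with i h1 h2
  exact (h _ _ _ _ (hx i) (hy i) h1 h2).le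

theorem exists_isGradientCurve [CompleteSpace X] (hbot : ∀ x, φ x ≠ ⊥) (hμ : 0 ≤ μ) (hκ : 0 ≤ κ)
    (hres : ResolventIneq φ μ κ) (hx₀ : φ x₀ ≠ ⊤) {τs : ℝ≥0∞} (hcoer : Coercive φ τs)
    (hτ : 0 < τ) (hτs : ENNReal.ofReal τ < τs) : ∃ ξ, IsGradientCurve φ x₀ ξ := by
  have hτb := (hcoer.2 x₀ τ hτ hτs).1
  have hpos : ∀ i : ℕ, 0 < τ / (i + 1 : ℝ) := fun i => by positivity
  have hle : ∀ i : ℕ, τ / (i + 1 : ℝ) ≤ τ := fun i =>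
    div_le_self hτ.le (by linarith [(Nat.cast_nonneg i : (0 : ℝ) ≤ i)])
  choose x hx using fun i : ℕ => exists_discreteSolution (hpos i) (fun z =>
    (hcoer.2 z _ (hpos i) ((ENNReal.ofReal_le_ofReal (hle i)).trans_lt hτs)).2) x₀
  have hmesh : Tendsto (fun i : ℕ => (uniformPartition _ (hpos i)).mesh) atTop (𝓝 0) := by
    simp only [uniformPartition_mesh]
    rw [← ENNReal.ofReal_zero]
    refine ENNReal.tendsto_ofReal ?_
    have := (tendsto_one_div_add_atTop_nhds_zero_nat (𝕜 := ℝ)).const_mul τ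
    simpa [div_eq_mul_inv] using this
  have hcau : ∀ t, 0 ≤ t → ∃ p, Tendsto (fun i => interp (uniformPartition _ (hpos i)) (x i) t)
      atTop (𝓝 p) := by
    intro t ht
    refine cauchySeq_tendsto_of_complete (Metric.cauchySeq_iff.2 fun ε hε => ?_)
    obtain ⟨δ, hδ, h⟩ := exists_dist_interp_lt hbot hμ hκ hres hx₀ hτ hτb ht hε
    obtain ⟨N, hN⟩ := eventually_atTop.1 (hmesh.eventually_lt_const (ENNReal.ofReal_pos.2 hδ))
    exact ⟨N, fun m hm n hn => h _ _ _ _ (hx m) (hx n) (hN m hm) (hN n hn)⟩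
  have : Nonempty X := ⟨x₀⟩
  choose! ξ hξ using hcau
  exact ⟨ξ, _, x, hx, hmesh, hξ⟩

/-- The curve chosen in `gradientFlow` is the same for every `t`. -/
theorem gradientFlow_isGradientCurve (h : ∃ ξ : ℝ → X, IsGradientCurve φ x₀ ξ) :
    IsGradientCurve φ x₀ fun t => gradientFlow φ t x₀ := by
  have : (fun t => gradientFlow φ t x₀) = h.choose := by
    funext t
    rw [gradientFlow, dif_pos h]
  rw [this]
  exact h.choose_spec

theorem exists_resolventIneq (hbot : ∀ x, φ x ≠ ⊥) {l K : ℝ} (hconv : IsSemiConvex φ l)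
    (hcase : (IsCAT1 X ∧ Metric.ediam (Set.univ : Set X) < ENNReal.ofReal (Real.pi / 2)) ∨
      HasCommutingGeodesics φ l K) : ResolventIneq φ (-l) (-min 0 K) := by
  rcases hcase with ⟨hcat, hdiam⟩ | hcomm
  · refine (resolventIneq_of_isCAT1 hbot hconv hcat fun x y => ?_).mono
      (neg_nonneg.2 (min_le_left _ _))
    rw [← edist_lt_ofReal]
    exact (Metric.edist_le_ediam_of_mem (mem_univ x) (mem_univ y)).trans_lt hdiam
  · exact resolventIneq_of_commuting hbot hcomm

end Convergence

end MetricGF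

end

/-! ### Assembly: uniqueness, error estimate and rate -/

theorem corollary4p3 {X : Type*} [MetricSpace X] [CompleteSpace X]
    (φ : X → EReal) (hbot : ∀ x, φ x ≠ ⊥) (hlsc : LowerSemicontinuous φ)
    (l K : ℝ) (hl : l ≤ 0) (hconv : MetricGF.IsSemiConvex φ l)
    (τs : ℝ≥0∞) (hcoer : MetricGF.Coercive φ τs)
    (hcase : (MetricGF.IsCAT1 X ∧ Metric.ediam (Set.univ : Set X) < ENNReal.ofReal (Real.pi / 2)) ∨
      MetricGF.HasCommutingGeodesics φ l K)
    (x₀ : X) (hx₀ : φ x₀ ≠ ⊤) :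
    -- the gradient curve from `x₀` exists, is unique, and is `t ↦ 𝒢(t, x₀)`
    (∀ ξ : ℝ → X, MetricGF.IsGradientCurve φ x₀ ξ ↔
      ∀ t : ℝ, 0 ≤ t → ξ t = MetricGF.gradientFlow φ t x₀) ∧
    -- the error estimate
    (∀ (P : MetricGF.TimePartition) (x : ℕ → X), P.mesh < τs →
      MetricGF.IsDiscreteSolution φ P x₀ x → ∀ t : ℝ, 0 < t →
        MetricGF.interpDist P x t (MetricGF.gradientFlow φ t x₀) ^ 2 ≤
          Real.exp (-2 * l * t) *
            (Real.sqrt (1 - min 0 K - 2 * l / 3 * P.mesh.toReal) +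
              Real.sqrt (-(4 * l / 3) * P.mesh.toReal)) ^ 2 *
            P.mesh.toReal * ((φ x₀).toReal - (φ (MetricGF.interp P x t)).toReal)) ∧
    -- the resulting rate on bounded time intervals
    (∀ T : ℝ, 0 < T → ∃ C δ : ℝ, 0 < δ ∧
      ∀ (P : MetricGF.TimePartition) (x : ℕ → X), P.mesh < ENNReal.ofReal δ →
        MetricGF.IsDiscreteSolution φ P x₀ x → ∀ t : ℝ, 0 < t → t ≤ T →
          MetricGF.interpDist P x t (MetricGF.gradientFlow φ t x₀) ≤
            C * Real.sqrt P.mesh.toReal) := by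
  have hμ : 0 ≤ -l := neg_nonneg.2 hl
  have hκ : 0 ≤ -min 0 K := neg_nonneg.2 (min_le_left _ _)
  have hres := MetricGF.exists_resolventIneq hbot hconv hcase
  obtain ⟨τ, hτ0, hτs⟩ := ENNReal.lt_iff_exists_nnreal_btwn.1 hcoer.1
  have hτ : 0 < (τ : ℝ) := by exact_mod_cast hτ0
  have hτs' : ENNReal.ofReal (τ : ℝ) < τs := by rwa [ENNReal.ofReal_coe_nnreal]
  have hτb := (hcoer.2 x₀ τ hτ hτs').1
  have hflow := MetricGF.gradientFlow_isGradientCurve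
    (MetricGF.exists_isGradientCurve hbot hμ hκ hres hx₀ hcoer hτ hτs')
  have hest : ∀ (P : MetricGF.TimePartition) (x : ℕ → X), P.mesh ≠ ⊤ →
      MetricGF.IsDiscreteSolution φ P x₀ x → ∀ t : ℝ, 0 < t →
        MetricGF.interpDist P x t (MetricGF.gradientFlow φ t x₀) ^ 2 ≤
          Real.exp (-2 * l * t) *
            (Real.sqrt (1 - min 0 K - 2 * l / 3 * P.mesh.toReal) +
              Real.sqrt (-(4 * l / 3) * P.mesh.toReal)) ^ 2 *
            P.mesh.toReal * ((φ x₀).toReal - (φ (MetricGF.interp P x t)).toReal) := by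
    intro P x hP hx t ht
    have h := MetricGF.interpDist_sq_le hbot hμ hκ hres hx₀ hτ hτb hflow hx
      (P.step_le_mesh hP) ht
    convert h using 6 <;> ring_nf
  refine ⟨fun ξ => ⟨fun hξ t ht =>
    MetricGF.isGradientCurve_unique hbot hμ hκ hres hx₀ hτ hτb hξ hflow ht, fun hξ => ?_⟩,
    fun P x hP => hest P x hP.ne_top, fun T hT => ?_⟩
  · obtain ⟨P, x, hx, hP, hlim⟩ := hflow
    -- Being a gradient curve depends only on the values at `t ≥ 0`.
    exact ⟨P, x, hx, hP, fun t ht => by rw [hξ t ht]; exact hlim t ht⟩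
  · obtain ⟨H, δ, hH, hδ, hE⟩ := MetricGF.exists_interp_energy_bound hbot hx₀ hτ hτb T
    -- As `l ≤ 0`, the prefactor of the estimate increases with time and mesh, so its value at `T`
    -- and `δ` dominates.
    set M := Real.exp (-2 * l * T) * (Real.sqrt (1 - min 0 K - 2 * l / 3 * δ) +
      Real.sqrt (-(4 * l / 3) * δ)) ^ 2 with hM
    refine ⟨Real.sqrt (M * H), δ, hδ, fun P x hP hx t ht htT => ?_⟩
    have hPδ : P.mesh.toReal ≤ δ := (ENNReal.toReal_lt_of_lt_ofReal hP).le
    have hm : 0 ≤ P.mesh.toReal := ENNReal.toReal_nonneg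
    rw [← Real.sqrt_mul (by positivity)]
    refine Real.le_sqrt_of_sq_le ((hest P x hP.ne_top hx t ht).trans ?_)
    have h1 : Real.exp (-2 * l * t) * (Real.sqrt (1 - min 0 K - 2 * l / 3 * P.mesh.toReal) +
        Real.sqrt (-(4 * l / 3) * P.mesh.toReal)) ^ 2 ≤ M := by
      have e1 := mul_le_mul_of_nonneg_left htT hμ
      have e2 := mul_le_mul_of_nonneg_left hPδ hμ
      refine mul_le_mul (Real.exp_le_exp.2 (by linarith)) ?_ (sq_nonneg _) (Real.exp_pos _).le
      exact pow_le_pow_left₀ (by positivity) (add_le_add (Real.sqrt_le_sqrt (by linarith))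
        (Real.sqrt_le_sqrt (by linarith))) 2
    have hM0 : 0 ≤ M := by positivity
    calc _ ≤ Real.exp (-2 * l * t) * (Real.sqrt (1 - min 0 K - 2 * l / 3 * P.mesh.toReal) +
        Real.sqrt (-(4 * l / 3) * P.mesh.toReal)) ^ 2 * P.mesh.toReal * H :=
          mul_le_mul_of_nonneg_left (hE P x hx hP t ht htT) (by positivity)
      _ ≤ M * P.mesh.toReal * H :=
          mul_le_mul_of_nonneg_right (mul_le_mul_of_nonneg_right h1 hm) hH
      _ = M * H * P.mesh.toReal := by ring
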